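/- **Setting.** There are $L$ independent routes; route $l$ has $N_l$ stages. New sessions arrive on route $l$ according to a homogeneous Poisson process of rate $\lambda_{l0}>0$. Each session on route $l$ carries a duration $T_l$ and dwell times $\tau_{l1},\dots,\tau_{lN_l}$; their joint law is arbitrary (any dependence is allowed) subject to $T_l>0$ and $\tau_{lj}\ge 0$ almost surely and to the two conditions below. Distinct sessions of a route are i.i.d. and independent of the arrival process. A session reaches stage $j$ if $\sum_{i<j}\tau_{li}<T_l$; it then enters stage $j$ at age $\sum_{i<j}\tau_{li}$ and stays there for the channel holding time $t_{lj}=\min\{T_l-\sum_{i<j}\tau_{li},\,\tau_{lj}\}$. It leaves the network when its duration has elapsed or when it exits the last stage. There is no limit on the number of users in a stage. Let $p_{lk}=P\big[\sum_{i<k}\tau_{li}<T_l\le\sum_{i\le k}\tau_{li}\big]$ for $k<N_l$ and $p_{lN_l}=P\big[\sum_{i<N_l}\tau_{li}<T_l\big]$ be the probability that a session lasts exactly $k$ (respectively $N_l$) stages, and let $\overline t_{lj}=E[t_{lj}\mid \text{stage } j \text{ is reached}]$. Assume that every stage is reached with positive probability and that $0<\overline t_{lj}<\infty$. Put $\lambda_{lj}=1/\overline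 t_{lj}$ and $$w_{lj}=\frac{\lambda_{l0}\,\big(1-\sum_{n=1}^{j-1}p_{ln}\big)}{\lambda_{lj}} .$$ The corresponding *memoryless network* is the continuous-time Markov chain on vectors $\mathbf x=(x_{lj})$ of nonnegative integers that consists of $L$ parallel tandem Jackson networks with infinitely many exponential servers at each queue: external arrivals enter queue $(l,1)$ at rate $\lambda_{l0}$; a user moves from queue $(l,k)$ to queue $(l,k+1)$ at total rate $x_{lk}\lambda_{lk}\frac{\sum_{j\ge k+1}p_{lj}}{\sum_{j\ge k}p_{lj}}$; and a user leaves the network from queue $(l,k)$ at total rate $x_{lk}\lambda_{lk}\frac{p_{lk}}{\sum_{j\ge k}p_{lj}}$. Its stationary distributions are the probability distributions that solve its global balance equations. **Theorem.** Let $$\pi(\mathbf x)=\prod_{l=1}^{L}\prod_{j=1}^{N_l}e^{-w_{lj}}\frac{w_{lj}^{x_{lj}}}{x_{lj}!}.$$ Then $\pi$ is a probability distribution and is the stationary user distribution of the multiple-route network: if the network has been running since time $-\infty$ (Poisson arrivals on the whole real line), the vector of numbers of users in all stages of all routes has law $\pi$ at every time $t$; and if the network is started empty at time $0$, the law of this vector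 at time $t$ converges to $\pi$ as $t\to\infty$. Moreover $\pi$ is the unique stationary distribution of the corresponding memoryless network, so the two networks have the same stationary user distribution. -/

import Mathlib

open MeasureTheory ProbabilityTheory Filter Topology
open scoped ENNReal Nat

noncomputable section

namespace MobileNetwork

/-! ### A single session on a route with `n` stages (stages are numbered from `0`) -/

/-- The data of a session: the session duration `T` and the cell dwell times `τ j` of the user in
the successive stages of the route (the first one being the residual dwell time). -/
abbrev Session (n : ℕ) : Type := ℝ × (Fin n → ℝ)

/-- Time from the start of the session to the entry into stage `j`: the sum of the dwell times in
the previous stages. -/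
def entryTime {n : ℕ} (s : Session n) (j : Fin n) : ℝ := ∑ i ∈ Finset.Iio j, s.2 i

/-- The session is still active when its user enters stage `j`. -/
def Reaches {n : ℕ} (s : Session n) (j : Fin n) : Prop := entryTime s j < s.1

/-- The channel holding time `t j = min {T - ∑ i < j, τ i, τ j}`, meaningful if `j` is reached. -/
def holdingTime {n : ℕ} (s : Session n) (j : Fin n) : ℝ := min (s.1 - entryTime s j) (s.2 j)

/-- At age `a` (time elapsed since its arrival) the session is active and in stage `j`. -/
def InStage {n : ℕ} (s : Session n) (j : Fin n) (a : ℝ) : Prop :=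
  Reaches s j ∧ entryTime s j ≤ a ∧ a < entryTime s j + holdingTime s j

/-- The session ends in stage `k`, i.e. it lasts exactly `k + 1` stages. There is no upper bound on
`T` if `k` is the last stage of the route. -/
def EndsInStage {n : ℕ} (s : Session n) (k : Fin n) : Prop :=
  ∑ i ∈ Finset.Iio k, s.2 i < s.1 ∧ (k.val + 1 < n → s.1 ≤ ∑ i ∈ Finset.Iic k, s.2 i)

/-! ### Parameters of a route, computed from the joint law `D` of `(T, τ)` -/

/-- `p k`: probability that a session ends in stage `k`. -/
def endProb {n : ℕ} (D : Measure (Session n)) (k : Fin n) : ℝ := D.real {s | EndsInStage s k}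

/-- Mean channel holding time in stage `j`, given that stage `j` is reached. -/
def meanHoldingTime {n : ℕ} (D : Measure (Session n)) (j : Fin n) : ℝ :=
  ∫ s, holdingTime s j ∂(cond D {s | Reaches s j})

/-- Service rate of the `j`-th queue of the memoryless network. -/
def serviceRate {n : ℕ} (D : Measure (Session n)) (j : Fin n) : ℝ := 1 / meanHoldingTime D j

/-- Routing probability from queue `j` to the next queue of the memoryless network. -/
def advanceProb {n : ℕ} (D : Measure (Session n)) (j : Fin n) : ℝ :=
  (∑ i ∈ Finset.Ioi j, endProb D i) / ∑ i ∈ Finset.Ici j, endProb D i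

/-- Routing probability from queue `j` to the outside world in the memoryless network. -/
def exitProb {n : ℕ} (D : Measure (Session n)) (j : Fin n) : ℝ :=
  endProb D j / ∑ i ∈ Finset.Ici j, endProb D i

/-- `w j = w' j / (service rate of queue j)`, where `w' j = lam0 * (1 - ∑ n < j, p n)` is the
invariant measure of the routing and `lam0` is the rate of arrivals of new sessions. -/
def offeredLoad {n : ℕ} (lam0 : ℝ) (D : Measure (Session n)) (j : Fin n) : ℝ :=
  lam0 * (1 - ∑ i ∈ Finset.Iio j, endProb D i) / serviceRate D j

/-! ### The network with `L` routes, route `l` having `N l` stages -/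

/-- Occupancy vectors `x`: the number of users in each stage of each route. -/
abbrev State {L : ℕ} (N : Fin L → ℕ) : Type := (Σ l : Fin L, Fin (N l)) → ℕ

section Original

variable {Ω : Type*} [MeasurableSpace Ω]

/-- Number of points of the (enumerated) random point set `{A n}` that lie in `B`. -/
def pointCount (A : ℕ → Ω → ℝ) (B : Set ℝ) (ω : Ω) : ℕ∞ := {n | A n ω ∈ B}.encard

/-- The random points `A n` (listed in any order) form a homogeneous Poisson process of the given
rate on the whole real line: the number of points in a Borel set of finite length is Poisson
distributed with mean `rate * length`, and the numbers of points in pairwise disjoint Borel sets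
of finite length are independent. -/
structure IsPoissonProcess (μ : Measure Ω) (rate : ℝ) (A : ℕ → Ω → ℝ) : Prop where
  measurable : ∀ n, Measurable (A n)
  count_law : ∀ B : Set ℝ, MeasurableSet B → volume B ≠ ∞ →
    μ.map (pointCount A B) =
      (poissonMeasure (rate * volume.real B).toNNReal).map (Nat.cast : ℕ → ℕ∞)
  count_indep : ∀ (m : ℕ) (B : Fin m → Set ℝ),
    (∀ i, MeasurableSet (B i)) → (∀ i, volume (B i) ≠ ∞) →
    Pairwise (Function.onFun Disjoint B) → iIndepFun (fun i => pointCount A (B i)) μ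

variable {L : ℕ} {N : Fin L → ℕ}

/-- `A l n` is the arrival time of the `n`-th session on route `l` and `S l n` is its data.
On each route the arrivals form a Poisson process of rate `lam0 l`; the sessions are i.i.d. with
law `D l` (a joint law for `(T, τ)`, arbitrary dependence within a session) and independent of the
arrivals; different routes are independent. -/
structure IsNetwork (μ : Measure Ω) (lam0 : Fin L → ℝ) (D : ∀ l, Measure (Session (N l)))
    (A : Fin L → ℕ → Ω → ℝ) (S : ∀ l : Fin L, ℕ → Ω → Session (N l)) : Prop where
  arrivals : ∀ l, IsPoissonProcess μ (lam0 l) (A l)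
  measurable : ∀ l n, Measurable (S l n)
  session_law : ∀ l n, μ.map (S l n) = D l
  session_indep : ∀ l, iIndepFun (S l) μ
  arrivals_indep_sessions : ∀ l, IndepFun (fun ω n => A l n ω) (fun ω n => S l n ω) μ
  routes_indep : iIndepFun (fun l ω => ((fun n => A l n ω), (fun n => S l n ω))) μ

/-- Number of users that are in stage `q.2` of route `q.1` at time `t`, counting the sessions that
arrived during the time set `W`. -/
def occupancy (A : Fin L → ℕ → Ω → ℝ) (S : ∀ l : Fin L, ℕ → Ω → Session (N l)) (W : Set ℝ)
    (t : ℝ) (q : Σ l : Fin L, Fin (N l)) (ω : Ω) : ℕ∞ :=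
  {n | A q.1 n ω ∈ W ∧ InStage (S q.1 n ω) q.2 (t - A q.1 n ω)}.encard

end Original

section Memoryless

variable {L : ℕ} {N : Fin L → ℕ}

/-- One user in stage `j` of route `l`, and nobody elsewhere. -/
def oneUser (l : Fin L) (j : Fin (N l)) : State N := Pi.single ⟨l, j⟩ 1

/-- Transition rates `x → y` of the memoryless network (parallel tandem Jackson networks with
infinitely many exponential servers at each queue): external arrivals to the first queue of a
route, moves from a queue to the next queue of the same route, and departures. -/
def transitionRate (lam0 : Fin L → ℝ) (D : ∀ l, Measure (Session (N l))) (x y : State N) : ℝ≥0∞ :=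
  (∑ l, ∑ j : Fin (N l), if j.val = 0 ∧ y = x + oneUser l j then ENNReal.ofReal (lam0 l) else 0) +
  (∑ l, ∑ j : Fin (N l), ∑ k : Fin (N l),
    if k.val = j.val + 1 ∧ y + oneUser l j = x + oneUser l k then
      ENNReal.ofReal (x ⟨l, j⟩ * serviceRate (D l) j * advanceProb (D l) j) else 0) +
  (∑ l, ∑ j : Fin (N l), if y + oneUser l j = x then
      ENNReal.ofReal (x ⟨l, j⟩ * serviceRate (D l) j * exitProb (D l) j) else 0)

/-- A stationary distribution of the memoryless network: a probability distribution on the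
occupancy vectors that solves the global balance equations of the Markov jump process. -/
def IsMemorylessStationary (lam0 : Fin L → ℝ) (D : ∀ l, Measure (Session (N l)))
    (ν : PMF (State N)) : Prop :=
  ∀ x, ν x * ∑' y, transitionRate lam0 D x y = ∑' y, ν y * transitionRate lam0 D y x

end Memoryless

end MobileNetwork

end

/-! Arrivals marked with their sessions form a marked Poisson process. A user is in stage `j` at
time `t` exactly when its point (arrival time, session) lies in `presentSet`, and almost surely
these sets are disjoint for different stages. The occupancies of a route are therefore independent
Poisson variables with means rate times `markedMass` (`measure_encard_marked_eq`). For a fixed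
session, the arrival times that count form an interval whose length is the holding time, wherever
`t` is. By Tonelli the mean is `lam0 * P(reach) * E[holding time | reach]`, which is the offered
load; only this mean depends on the law of a session. With arrivals restricted to `[0, ∞)` the
interval is cut at `0`, and dominated convergence gives the limit.

The points are listed in an arbitrary order, so only counts in sets are available. The independence
statement is obtained from generating functions: `lintegral_infProd` evaluates `E ∏ (1 - v (A n))`
from the counts, first for simple functions and then by monotone approximation;
`lintegral_infProd_mark` averages out the marks; `ext_of_integral_prod_pow` recovers the joint law.

In the memoryless network, the throughput `w j * serviceRate j` equals the rate of sessions that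
reach stage `j`. Together with the Poisson recursion (`poissonState_add_oneUser`) this gives balance
stage by stage. Uniqueness is a maximum principle: if `ν` also solves the balance equations, so does
`min ν (c π)`, which forces `ν / π` to be monotone along transitions and hence constant by
irreducibility. The principle needs the mean total jump rate under `π` to be finite. -/

section GeneratingFunction

/-! ### Generating functions determine laws on `ι → ℕ`. -/

variable {ι : Type*} [Fintype ι]

theorem prod_pow_mem_Icc {u : ι → ℝ} (hu : ∀ i, u i ∈ Set.Icc (0 : ℝ) 1) (x : ι → ℕ) :
    ∏ i, u i ^ x i ∈ Set.Icc (0 : ℝ) 1 :=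
  ⟨Finset.prod_nonneg fun i _ => pow_nonneg (hu i).1 _,
    Finset.prod_le_one (fun i _ => pow_nonneg (hu i).1 _)
      fun i _ => pow_le_one₀ (hu i).1 (hu i).2⟩

/-- The monomial `x ↦ ∏ i, u i ^ x i` as a bounded continuous function. -/
noncomputable def boundedMonomial (u : ι → ℝ) (hu : ∀ i, u i ∈ Set.Icc (0 : ℝ) 1) :
    BoundedContinuousFunction (ι → ℕ) ℝ :=
  BoundedContinuousFunction.ofNormedAddCommGroupDiscrete (fun x => ∏ i, u i ^ x i) 1 fun x => by
    rw [Real.norm_of_nonneg (prod_pow_mem_Icc hu x).1]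
    exact (prod_pow_mem_Icc hu x).2

/-- The monomials form a multiplicative monoid of bounded continuous functions. -/
noncomputable def boundedMonomials (ι : Type*) [Fintype ι] :
    Submonoid (BoundedContinuousFunction (ι → ℕ) ℝ) where
  carrier := {f | ∃ u hu, f = boundedMonomial (ι := ι) u hu}
  one_mem' := ⟨fun _ => 1, fun _ => by simp, by ext x; simp [boundedMonomial]⟩
  mul_mem' := by
    rintro _ _ ⟨u, hu, rfl⟩ ⟨v, hv, rfl⟩
    refine ⟨fun i => u i * v i, fun i => ⟨mul_nonneg (hu i).1 (hv i).1,
      mul_le_one₀ (hu i).2 (hv i).1 (hv i).2⟩, ?_⟩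
    ext x
    simp [boundedMonomial, mul_pow, Finset.prod_mul_distrib]

/-- A finite measure on `ι → ℕ` is determined by its probability generating function. -/
theorem ext_of_integral_prod_pow {P Q : Measure (ι → ℕ)} [IsFiniteMeasure P] [IsFiniteMeasure Q]
    (h : ∀ u : ι → ℝ, (∀ i, u i ∈ Set.Icc (0 : ℝ) 1) →
      ∫ x, ∏ i, u i ^ x i ∂P = ∫ x, ∏ i, u i ^ x i ∂Q) : P = Q := by
  classical
  let B : Subalgebra ℝ (BoundedContinuousFunction (ι → ℕ) ℝ) :=
    Algebra.adjoin ℝ (boundedMonomials ι : Set (BoundedContinuousFunction (ι → ℕ) ℝ))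
  let B' : StarSubalgebra ℝ (BoundedContinuousFunction (ι → ℕ) ℝ) :=
    { B with
      star_mem' := by
        intro f hf
        rwa [show star f = f by ext x; simp] }
  refine ext_of_forall_mem_subalgebra_integral_eq_of_pseudoEMetric_complete_countable
    (A := B') ?_ ?_
  · intro x y hxy
    obtain ⟨i, hi⟩ := Function.ne_iff.1 hxy
    -- Points are separated by the monomial `z ↦ 2 ^ (-z i)`, where `i` is a coordinate in which `x`
    -- and `y` differ.
    have hu : ∀ k, Function.update (fun _ : ι => (1 : ℝ)) i (1 / 2) k ∈ Set.Icc (0 : ℝ) 1 := by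
      intro k
      rcases eq_or_ne k i with rfl | hk
      · simp; norm_num
      · simp [hk]
    have hval : ∀ z : ι → ℕ, boundedMonomial _ hu z = (1 / 2) ^ z i := by
      intro z
      simp only [boundedMonomial, BoundedContinuousFunction.coe_ofNormedAddCommGroupDiscrete]
      rw [Finset.prod_eq_single i]
      · simp
      · intro b _ hb; simp [hb]
      · simp
    refine ⟨_, ⟨_, ⟨boundedMonomial _ hu, Algebra.subset_adjoin ⟨_, hu, rfl⟩, rfl⟩, rfl⟩, ?_⟩
    change boundedMonomial _ hu x ≠ boundedMonomial _ hu y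
    rw [hval, hval]
    intro h
    exact hi (pow_right_injective₀ (by norm_num) (by norm_num) h)
  · intro g hg
    -- Monomials are closed under products, so the algebra they generate is their linear span and
    -- equality of integrals extends by linearity.
    have hg' : g ∈ Submodule.span ℝ
        (boundedMonomials ι : Set (BoundedContinuousFunction (ι → ℕ) ℝ)) := by
      have : g ∈ Subalgebra.toSubmodule B := hg
      rwa [Algebra.adjoin_eq_span, Submonoid.closure_eq] at this
    clear hg
    induction hg' using Submodule.span_induction with
    | mem f hf => obtain ⟨u, hu, rfl⟩ := hf; exact h u hu
    | zero => simp
    | add f₁ f₂ _ _ h₁ h₂ =>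
      simp only [BoundedContinuousFunction.coe_add, Pi.add_apply]
      rw [integral_add (f₁.integrable _) (f₂.integrable _),
        integral_add (f₁.integrable _) (f₂.integrable _), h₁,
        h₂]
    | smul c f _ h₁ =>
      simp only [BoundedContinuousFunction.coe_smul]
      rw [integral_smul, integral_smul, h₁]

end GeneratingFunction

/-- Probability generating function of the Poisson distribution. -/
theorem lintegral_pow_poissonMeasure (r : NNReal) {u : ℝ} (hu : 0 ≤ u) :
    ∫⁻ n, ENNReal.ofReal u ^ n ∂(poissonMeasure r) = ENNReal.ofReal (Real.exp (-((1 - u) * r))) := by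
  have h1 : ∀ n : ℕ, ENNReal.ofReal u ^ n * ENNReal.ofReal (Real.exp (-r) * r ^ n / n !) =
      ENNReal.ofReal (Real.exp (-r) * ((u * r) ^ n / n !)) := by
    intro n
    rw [← ENNReal.ofReal_pow hu, ← ENNReal.ofReal_mul (by positivity)]
    congr 1
    rw [mul_pow]; ring
  have h2 : HasSum (fun n : ℕ => Real.exp (-r) * ((u * r) ^ n / n !))
      (Real.exp (-((1 - u) * r))) := by
    have := (NormedSpace.expSeries_div_hasSum_exp (u * r : ℝ)).mul_left (Real.exp (-r))
    rw [← Real.exp_eq_exp_ℝ, ← Real.exp_add] at this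
    rwa [show -(r : ℝ) + u * r = -((1 - u) * r) by ring] at this
  rw [lintegral_countable']
  simp_rw [poissonMeasure_singleton, h1]
  rw [← ENNReal.ofReal_tsum_of_nonneg (fun n => by positivity) h2.summable, h2.tsum_eq]

/-! ### Uniqueness for global balance equations. -/

section GlobalBalance

variable {X : Type*}

/-- Maximum principle behind the uniqueness of stationary distributions: the truncations
`min ν (c π)` of a solution `ν` of the balance equations are solutions too. -/
theorem le_of_balance_of_rate_pos {q : X → X → ℝ≥0∞} {π ν : X → ℝ≥0∞}
    (hπ0 : ∀ x, π x ≠ 0) (hπt : ∀ x, π x ≠ ∞)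
    (hfin : ∑' x, π x * ∑' y, q x y ≠ ∞)
    (hπ : ∀ x, π x * ∑' y, q x y = ∑' y, π y * q y x)
    (hν : ∀ x, ν x * ∑' y, q x y = ∑' y, ν y * q y x) (hνt : ∀ x, ν x ≠ ∞)
    {x y : X} (hyx : q y x ≠ 0) : ν x / π x ≤ ν y / π y := by
  -- With this `c`, the solutions `ν` and `c π` agree at `x`.
  set c := ν x / π x with hc
  have hct : c ≠ ∞ := ENNReal.div_ne_top (hνt x) (hπ0 x)
  have hcx : c * π x = ν x := ENNReal.div_mul_cancel (hπ0 x) (hπt x)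
  set m : X → ℝ≥0∞ := fun z => min (ν z) (c * π z) with hm
  have hqx : ∀ z, ∑' y, q z y ≠ ∞ := fun z h => by
    refine hfin (ENNReal.tsum_eq_top_of_eq_top ⟨z, ?_⟩)
    rw [h, ENNReal.mul_top (hπ0 z)]
  -- The inflow of `m` is at most that of each of the two solutions, in particular of the one that
  -- realises the minimum at `z`.
  have hsub : ∀ z, ∑' y, m y * q y z ≤ m z * ∑' y, q z y := by
    intro z
    have h1 : ∑' y, m y * q y z ≤ ν z * ∑' y, q z y := by
      rw [hν]
      exact ENNReal.tsum_le_tsum fun y => by gcongr; exact min_le_left _ _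
    have h2 : ∑' y, m y * q y z ≤ c * π z * ∑' y, q z y := by
      rw [mul_assoc, hπ, ← ENNReal.tsum_mul_left]
      exact ENNReal.tsum_le_tsum fun y => by rw [← mul_assoc]; gcongr; exact min_le_right _ _
    rcases min_choice (ν z) (c * π z) with h | h
    · simp only [hm, h]; exact h1
    · simp only [hm, h]; exact h2
  -- Total inflow equals total outflow by exchanging sums. As the total is finite, no inequality in
  -- `hsub` can be strict.
  have htot : ∑' z, ∑' y, m y * q y z = ∑' z, m z * ∑' y, q z y := by
    rw [ENNReal.tsum_comm]
    simp_rw [ENNReal.tsum_mul_left]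
  have htot_fin : ∑' z, m z * ∑' y, q z y ≠ ∞ := by
    refine ne_top_of_le_ne_top (ENNReal.mul_ne_top hct hfin) ?_
    rw [← ENNReal.tsum_mul_left]
    exact ENNReal.tsum_le_tsum fun y => by rw [← mul_assoc]; gcongr; exact min_le_right _ _
  have heq : ∑' y, m y * q y x = m x * ∑' y, q x y := by
    refine le_antisymm (hsub x) (not_lt.1 fun hlt => ?_)
    exact absurd htot (ENNReal.tsum_lt_tsum (htot ▸ htot_fin) hsub hlt).ne
  have hmx : m x = c * π x := by simp [hm, hcx]
  -- At `x` the inflows of `m` and `c π` coincide although `m ≤ c π` termwise, so every term agrees,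
  -- including the one from `y`.
  have heq2 : ∑' z, m z * q z x = ∑' z, c * π z * q z x := by
    rw [heq, hmx, mul_assoc, hπ, ← ENNReal.tsum_mul_left]
    simp_rw [mul_assoc]
  have hy : m y * q y x = c * π y * q y x := by
    refine le_antisymm (by gcongr; exact min_le_right _ _) (not_lt.1 fun hlt => ?_)
    refine absurd heq2 (ENNReal.tsum_lt_tsum (i := y) ?_
      (fun z => by gcongr; exact min_le_right _ _) hlt).ne
    rw [heq]
    exact ENNReal.mul_ne_top (by rw [hmx, hcx]; exact hνt x) (hqx x)
  have hqy : q y x ≠ ∞ := ne_top_of_le_ne_top (hqx y) (ENNReal.le_tsum x)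
  have hmy : m y = c * π y := (ENNReal.mul_left_inj hyx hqy).1 hy
  rw [ENNReal.le_div_iff_mul_le (Or.inl (hπ0 y)) (Or.inl (hπt y)), ← hmy]
  exact min_le_left _ _

/-- Uniqueness of the stationary distribution of an irreducible chain that has a positive
stationary distribution with finite mean total rate. -/
theorem PMF.eq_of_balance {q : X → X → ℝ≥0∞} {π ν : PMF X} (hπ0 : ∀ x, π x ≠ 0)
    (hfin : ∑' x, π x * ∑' y, q x y ≠ ∞)
    (hirr : ∀ x y, Relation.ReflTransGen (fun a b => q a b ≠ 0) x y)
    (hπ : ∀ x, π x * ∑' y, q x y = ∑' y, π y * q y x)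
    (hν : ∀ x, ν x * ∑' y, q x y = ∑' y, ν y * q y x) : ν = π := by
  have hle : ∀ x y, ν x / π x ≤ ν y / π y := by
    intro x y
    have h := hirr y x
    induction h with
    | refl => exact le_rfl
    | tail _ hbc ih =>
      exact (le_of_balance_of_rate_pos hπ0 π.apply_ne_top hfin hπ hν ν.apply_ne_top hbc).trans ih
  obtain ⟨x0, -⟩ := π.support_nonempty
  have hmul : ∀ x, ν x = (ν x0 / π x0) * π x := fun x => by
    rw [le_antisymm (hle x0 x) (hle x x0), ENNReal.div_mul_cancel (hπ0 x) (π.apply_ne_top x)]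
  have hone : ν x0 / π x0 = 1 := by
    have h := ν.tsum_coe
    rw [tsum_congr hmul] at h
    rwa [ENNReal.tsum_mul_left, π.tsum_coe, mul_one] at h
  ext x
  rw [hmul, hone, one_mul]

end GlobalBalance

/-! ### Infinite products and counts of indices. -/

/-- The infinite product of a sequence in `[0, 1]`, as the infimum of its partial products. -/
noncomputable def infProd (f : ℕ → ℝ≥0∞) : ℝ≥0∞ := ⨅ N, ∏ n ∈ Finset.range N, f n

theorem antitone_prod_range {f : ℕ → ℝ≥0∞} (hf : ∀ n, f n ≤ 1) :
    Antitone fun N => ∏ n ∈ Finset.range N, f n :=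
  antitone_nat_of_succ_le fun N => by
    rw [Finset.prod_range_succ]
    exact mul_le_of_le_one_right' (hf N)

theorem prod_range_ite_mem (I : Set ℕ) [DecidablePred (· ∈ I)] (u : ℝ≥0∞) (N : ℕ) :
    ∏ n ∈ Finset.range N, (if n ∈ I then u else 1) =
      u ^ ((Finset.range N).filter (· ∈ I)).card := by
  rw [← Finset.prod_filter, Finset.prod_const]

/-- Partial products decrease and are constant beyond the largest index occurring in any `I i`. The
sets `I i` may overlap. -/
theorem infProd_prod_ite_mem {ι : Type*} [Fintype ι] {I : ι → Set ℕ} (hI : ∀ i, (I i).Finite)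
    [∀ i, DecidablePred (· ∈ I i)] {u : ι → ℝ≥0∞} (hu : ∀ i, u i ≤ 1) :
    infProd (fun n => ∏ i, if n ∈ I i then u i else 1) = ∏ i, u i ^ (I i).encard.toNat := by
  have key : ∀ N, ∏ n ∈ Finset.range N, ∏ i, (if n ∈ I i then u i else 1) =
      ∏ i, u i ^ ((Finset.range N).filter (· ∈ I i)).card := fun N => by
    rw [Finset.prod_comm]
    exact Finset.prod_congr rfl fun i _ => prod_range_ite_mem _ _ _
  simp only [infProd, key]
  apply le_antisymm
  · obtain ⟨N, hN⟩ := (Set.finite_iUnion hI).bddAbove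
    refine (iInf_le _ (N + 1)).trans_eq (Finset.prod_congr rfl fun i _ => ?_)
    congr 1
    rw [← Set.ncard_def, ← Set.ncard_coe_finset]
    congr 1
    ext n
    simp only [Finset.coe_filter, Finset.mem_range, Set.mem_ofPred_eq, and_iff_right_iff_imp]
    exact fun hn => Nat.lt_succ_of_le (hN (Set.mem_iUnion.2 ⟨i, hn⟩))
  · refine le_iInf fun N => Finset.prod_le_prod' fun i _ => pow_le_pow_right_of_le_one' (hu i) ?_
    rw [← Set.ncard_def, ← Set.ncard_coe_finset]
    exact Set.ncard_le_ncard (by intro n; simp) (hI i)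

/-- Some partial product contains `k` factors `u`, for every `k`. This lets a generating function
detect infinite counts. -/
theorem infProd_ite_mem_of_infinite {I : Set ℕ} (hI : I.Infinite) [DecidablePred (· ∈ I)]
    {u : ℝ≥0∞} (hu : u < 1) : infProd (fun n => if n ∈ I then u else 1) = 0 := by
  refine le_antisymm (ge_of_tendsto' (ENNReal.tendsto_pow_atTop_nhds_zero_of_lt_one hu)
    fun k => ?_) bot_le
  obtain ⟨t, htI, htk⟩ := hI.exists_subset_card_eq k
  obtain ⟨N, hN⟩ := t.bddAbove
  refine (iInf_le _ (N + 1)).trans ?_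
  rw [prod_range_ite_mem]
  refine pow_le_pow_right_of_le_one' hu.le ?_
  rw [← htk]
  refine Finset.card_le_card fun n hn => ?_
  simpa using ⟨hN hn, htI hn⟩

/-- The count is a countable sum of indicators in `ℝ≥0∞`, and on the countable space `ℕ∞` it is
enough to test singletons. -/
theorem measurable_encard_setOf {Ω : Type*} [MeasurableSpace Ω] {p : ℕ → Ω → Prop}
    (hp : ∀ n, MeasurableSet {ω | p n ω}) : Measurable fun ω => {n | p n ω}.encard := by
  classical
  have h : Measurable fun ω => (({n | p n ω}.encard : ℕ∞) : ℝ≥0∞) := by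
    have : (fun ω => (({n | p n ω}.encard : ℕ∞) : ℝ≥0∞)) =
        fun ω => ∑' n, {ω | p n ω}.indicator (fun _ => (1 : ℝ≥0∞)) ω := by
      ext ω
      rw [← ENNReal.tsum_set_one, tsum_subtype {n | p n ω} fun _ => (1 : ℝ≥0∞)]
      rfl
    rw [this]
    exact Measurable.tsum fun n => measurable_const.indicator (hp n)
  refine measurable_to_countable' fun k => ?_
  convert h (measurableSet_singleton (k : ℝ≥0∞)) using 1
  ext ω
  simp

/-! ### The generating functional of a Poisson process. -/

namespace MobileNetwork

variable {Ω : Type*} [MeasurableSpace Ω] {μ : Measure Ω} {rate : ℝ} {A : ℕ → Ω → ℝ}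

theorem IsPoissonProcess.measurable_pointCount (hA : IsPoissonProcess μ rate A) {B : Set ℝ}
    (hB : MeasurableSet B) : Measurable (pointCount A B) :=
  measurable_encard_setOf fun n => hA.measurable n hB

theorem IsPoissonProcess.ae_finite (hA : IsPoissonProcess μ rate A) {B : Set ℝ}
    (hB : MeasurableSet B) (hB' : volume B ≠ ∞) : ∀ᵐ ω ∂μ, {n | A n ω ∈ B}.Finite := by
  have h : ∀ᵐ k ∂(μ.map (pointCount A B)), k ≠ ⊤ := by
    rw [hA.count_law B hB hB']
    exact (ae_map_iff (by fun_prop) (by measurability)).2 (ae_of_all _ fun n => by simp)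
  filter_upwards [ae_of_ae_map (hA.measurable_pointCount hB).aemeasurable h] with ω hω
  exact Set.encard_ne_top_iff.1 hω

theorem IsPoissonProcess.lintegral_pow_pointCount (hA : IsPoissonProcess μ rate A)
    (hrate : 0 ≤ rate) {B : Set ℝ} (hB : MeasurableSet B) (hB' : volume B ≠ ∞) {u : ℝ}
    (hu : 0 ≤ u) :
    ∫⁻ ω, ENNReal.ofReal u ^ (pointCount A B ω).toNat ∂μ =
      ENNReal.ofReal (Real.exp (-((1 - u) * (rate * volume.real B)))) := by
  rw [← lintegral_map (f := fun k : ℕ∞ => ENNReal.ofReal u ^ k.toNat) (.of_discrete)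
    (hA.measurable_pointCount hB), hA.count_law B hB hB', lintegral_map (.of_discrete)
    (by fun_prop)]
  simp only [ENat.toNat_natCast]
  rw [lintegral_pow_poissonMeasure _ hu, Real.coe_toNNReal _ (by positivity)]

theorem IsPoissonProcess.lintegral_prod_pow_pointCount (hA : IsPoissonProcess μ rate A)
    (hrate : 0 ≤ rate) {ι : Type*} [Fintype ι] {B : ι → Set ℝ} (hB : ∀ i, MeasurableSet (B i))
    (hB' : ∀ i, volume (B i) ≠ ∞) (hdisj : Pairwise (Function.onFun Disjoint B)) {u : ι → ℝ}
    (hu : ∀ i, 0 ≤ u i) :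
    ∫⁻ ω, ∏ i, ENNReal.ofReal (u i) ^ (pointCount A (B i) ω).toNat ∂μ =
      ENNReal.ofReal (Real.exp (-(rate * ∑ i, (1 - u i) * volume.real (B i)))) := by
  let e := Fintype.equivFin ι
  have hind := hA.count_indep (Fintype.card ι) (fun k => B (e.symm k)) (fun k => hB _)
    (fun k => hB' _) (fun a b hab => hdisj (e.symm.injective.ne hab))
  have hind2 := hind.comp (fun k (c : ℕ∞) => ENNReal.ofReal (u (e.symm k)) ^ c.toNat)
    fun k => .of_discrete
  have h := lintegral_prod_eq_prod_lintegral_of_indepFun Finset.univ _ hind2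
    fun k => Measurable.comp .of_discrete (hA.measurable_pointCount (hB _))
  simp only [Function.comp_apply] at h
  have h1 : ∀ ω, ∏ k, ENNReal.ofReal (u (e.symm k)) ^ (pointCount A (B (e.symm k)) ω).toNat =
      ∏ i, ENNReal.ofReal (u i) ^ (pointCount A (B i) ω).toNat := fun ω =>
    e.symm.prod_comp fun i => ENNReal.ofReal (u i) ^ (pointCount A (B i) ω).toNat
  simp_rw [h1] at h
  rw [h, e.symm.prod_comp
    fun i => ∫⁻ ω, ENNReal.ofReal (u i) ^ (pointCount A (B i) ω).toNat ∂μ]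
  simp_rw [fun i => hA.lintegral_pow_pointCount hrate (hB i) (hB' i) (hu i)]
  rw [← ENNReal.ofReal_prod_of_nonneg (fun i _ => (Real.exp_pos _).le), ← Real.exp_sum,
    Finset.sum_neg_distrib, Finset.mul_sum]
  congr 3
  exact Finset.sum_congr rfl fun i _ => by ring

/-- A point in the level set `{v = c}` contributes the factor `1 - c`, so the product is a monomial
in the counts of the disjoint level sets, which are independent Poisson variables. -/
theorem IsPoissonProcess.lintegral_infProd_simpleFunc (hA : IsPoissonProcess μ rate A)
    (hrate : 0 ≤ rate) (v : SimpleFunc ℝ ℝ≥0∞) (hv : ∀ a, v a ≤ 1)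
    (hfin : ∫⁻ a, v a ≠ ∞) :
    ∫⁻ ω, infProd (fun n => 1 - v (A n ω)) ∂μ =
      ENNReal.ofReal (Real.exp (-(rate * (∫⁻ a, v a).toReal))) := by
  classical
  -- The level `0` is dropped: its points contribute the factor `1`, and it may have infinite
  -- length.
  let ι := {c // c ∈ v.range.filter (· ≠ 0)}
  let : Fintype ι := Finset.fintypeCoeSort (v.range.filter (· ≠ 0))
  let B : ι → Set ℝ := fun c => v ⁻¹' {c.1}
  let u : ι → ℝ := fun c => 1 - c.1.toReal
  have hle : ∀ c : ι, c.1 ≤ 1 := fun c => by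
    obtain ⟨a, ha⟩ := SimpleFunc.mem_range.1 (Finset.mem_filter.1 c.2).1
    rw [← ha]; exact hv a
  have hct : ∀ c : ι, c.1 ≠ ∞ := fun c => ne_top_of_le_ne_top ENNReal.one_ne_top (hle c)
  have hc1 : ∀ c : ι, c.1.toReal ≤ 1 := fun c => ENNReal.toReal_le_of_le_ofReal zero_le_one
    (by simpa using hle c)
  have hu : ∀ c, 0 ≤ u c := fun c => sub_nonneg.2 (hc1 c)
  have hofu : ∀ c : ι, ENNReal.ofReal (u c) = 1 - c.1 := fun c => by
    rw [ENNReal.ofReal_sub _ ENNReal.toReal_nonneg, ENNReal.ofReal_one,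
      ENNReal.ofReal_toReal (hct c)]
  have hB : ∀ c, MeasurableSet (B c) := fun c => v.measurableSet_preimage _
  have hfs : v.FinMeasSupp volume :=
    SimpleFunc.FinMeasSupp.of_lintegral_ne_top (by rwa [← SimpleFunc.lintegral_eq_lintegral])
  have hB' : ∀ c, volume (B c) ≠ ∞ := fun c =>
    (SimpleFunc.finMeasSupp_iff.1 hfs c.1 (Finset.mem_filter.1 c.2).2).ne
  have hdisj : Pairwise (Function.onFun Disjoint B) := fun c d hcd =>
    Set.disjoint_left.2 fun a ha hb => hcd (Subtype.ext (ha.symm.trans hb))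
  have hprod : ∀ a, 1 - v a = ∏ c : ι, if a ∈ B c then ENNReal.ofReal (u c) else 1 := by
    intro a
    by_cases ha : v a = 0
    · rw [ha, tsub_zero, Finset.prod_eq_one]
      intro c _
      rw [if_neg]
      intro hac
      exact (Finset.mem_filter.1 c.2).2 ((hac : v a = c.1).symm.trans ha)
    · let c : ι := ⟨v a, Finset.mem_filter.2 ⟨v.mem_range_self a, ha⟩⟩
      rw [Finset.prod_eq_single c]
      · rw [if_pos (by rfl), hofu]
      · intro d _ hd
        rw [if_neg]
        intro had
        exact hd (Subtype.ext (had : v a = d.1).symm)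
      · simp
  have hint : (∫⁻ a, v a).toReal = ∑ c : ι, (1 - u c) * volume.real (B c) := by
    rw [SimpleFunc.lintegral_eq_lintegral, v.lintegral_eq_of_subset' (s := v.range.filter (· ≠ 0))
      (by intro x hx; simpa using hx), ← Finset.sum_coe_sort, ENNReal.toReal_sum]
    · refine Finset.sum_congr rfl fun c _ => ?_
      rw [ENNReal.toReal_mul]
      simp [u, B, Measure.real]
    · exact fun c _ => ENNReal.mul_ne_top (hct c) (hB' c)
  rw [hint, ← hA.lintegral_prod_pow_pointCount hrate hB hB' hdisj hu]
  refine lintegral_congr_ae ?_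
  filter_upwards [ae_all_iff.2 fun c => hA.ae_finite (hB c) (hB' c)] with ω hω
  simp_rw [hprod]
  exact infProd_prod_ite_mem (I := fun c => {n | A n ω ∈ B c}) hω
    fun c => by rw [hofu]; exact tsub_le_self

theorem measurable_infProd {f : ℕ → Ω → ℝ≥0∞} (hf : ∀ n, Measurable (f n)) :
    Measurable fun ω => infProd fun n => f n ω :=
  Measurable.iInf fun _ => Finset.measurable_fun_prod _ fun n _ => hf n

theorem infProd_le_one (f : ℕ → ℝ≥0∞) : infProd f ≤ 1 := (iInf_le _ 0).trans (by simp)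

theorem infProd_mono {f g : ℕ → ℝ≥0∞} (h : ∀ n, f n ≤ g n) : infProd f ≤ infProd g :=
  iInf_mono fun _ => Finset.prod_le_prod' fun n _ => h n

/-- Probability generating functional of a Poisson process. -/
theorem IsPoissonProcess.lintegral_infProd [IsProbabilityMeasure μ] (hA : IsPoissonProcess μ rate A)
    (hrate : 0 ≤ rate) {v : ℝ → ℝ≥0∞} (hvm : Measurable v) (hv : ∀ a, v a ≤ 1)
    (hfin : ∫⁻ a, v a ≠ ∞) :
    ∫⁻ ω, infProd (fun n => 1 - v (A n ω)) ∂μ =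
      ENNReal.ofReal (Real.exp (-(rate * (∫⁻ a, v a).toReal))) := by
  let w : ℕ → SimpleFunc ℝ ℝ≥0∞ := SimpleFunc.eapprox v
  have hwm : Monotone w := SimpleFunc.monotone_eapprox v
  have hws : ∀ a, ⨆ k, w k a = v a := SimpleFunc.iSup_eapprox_apply hvm
  have hwv : ∀ k a, w k a ≤ v a := fun k a => (le_iSup (fun k => w k a) k).trans_eq (hws a)
  have hwt : ∀ a, Tendsto (fun k => w k a) atTop (𝓝 (v a)) := fun a => by
    rw [← hws a]; exact tendsto_atTop_iSup fun i j hij => hwm hij a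
  -- The infima over `k` and over the length `N` commute, and for fixed `N` the finite product is
  -- continuous in its factors.
  have hpt : ∀ ω, infProd (fun n => 1 - v (A n ω)) = ⨅ k, infProd (fun n => 1 - w k (A n ω)) := by
    intro ω
    simp only [infProd]
    rw [iInf_comm]
    congr 1
    ext N
    refine tendsto_nhds_unique (f := fun k => ∏ n ∈ Finset.range N, (1 - w k (A n ω)))
      (l := atTop) ?_ (tendsto_atTop_iInf fun i j hij => Finset.prod_le_prod' fun n _ =>
        tsub_le_tsub_left (hwm hij _) _)
    refine ENNReal.tendsto_finsetProd_of_ne_top _ (fun n _ => ?_) fun n _ => ?_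
    · exact ENNReal.Tendsto.sub tendsto_const_nhds (hwt _) (Or.inl ENNReal.one_ne_top)
    · exact ne_top_of_le_ne_top ENNReal.one_ne_top tsub_le_self
  have hmeas : ∀ k, Measurable fun ω => infProd (fun n => 1 - w k (A n ω)) := fun k =>
    measurable_infProd fun n => measurable_const.sub ((w k).measurable.comp (hA.measurable n))
  have hanti : Antitone fun k ω => infProd (fun n => 1 - w k (A n ω)) := fun i j hij ω =>
    infProd_mono fun n => tsub_le_tsub_left (hwm hij _) _
  simp_rw [hpt]
  rw [lintegral_iInf hmeas hanti (ne_top_of_le_ne_top ENNReal.one_ne_top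
    ((lintegral_mono fun ω => infProd_le_one _).trans (by simp)))]
  refine tendsto_nhds_unique (tendsto_atTop_iInf fun i j hij => lintegral_mono (hanti hij)) ?_
  have hwfin : ∀ k, ∫⁻ a, w k a ≠ ∞ := fun k => ne_top_of_le_ne_top hfin (lintegral_mono (hwv k))
  simp_rw [fun k => hA.lintegral_infProd_simpleFunc hrate (w k)
    (fun a => (hwv k a).trans (hv a)) (hwfin k)]
  have hlim : Tendsto (fun k => ∫⁻ a, w k a) atTop (𝓝 (∫⁻ a, v a)) :=
    lintegral_tendsto_of_tendsto_of_monotone (fun k => (w k).measurable.aemeasurable)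
      (ae_of_all _ fun a i j hij => hwm hij a) (ae_of_all _ hwt)
  have hlim' := (ENNReal.tendsto_toReal hfin).comp hlim
  exact (ENNReal.continuous_ofReal.tendsto _).comp
    ((Real.continuous_exp.tendsto _).comp (hlim'.const_mul rate).neg)

end MobileNetwork

/-! ### Generating functions as Lebesgue integrals; products of Poisson laws. -/

theorem ext_of_lintegral_prod_pow {ι : Type*} [Fintype ι] {P Q : Measure (ι → ℕ)}
    [IsFiniteMeasure P] [IsFiniteMeasure Q]
    (h : ∀ u : ι → ℝ, (∀ i, u i ∈ Set.Icc (0 : ℝ) 1) →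
      ∫⁻ x, ∏ i, ENNReal.ofReal (u i) ^ x i ∂P = ∫⁻ x, ∏ i, ENNReal.ofReal (u i) ^ x i ∂Q) :
    P = Q := by
  refine ext_of_integral_prod_pow fun u hu => ?_
  have hconv : ∀ x : ι → ℕ, ENNReal.ofReal (∏ i, u i ^ x i) =
      ∏ i, ENNReal.ofReal (u i) ^ x i := fun x => by
    rw [ENNReal.ofReal_prod_of_nonneg fun i _ => pow_nonneg (hu i).1 _]
    exact Finset.prod_congr rfl fun i _ => ENNReal.ofReal_pow (hu i).1 _
  rw [integral_eq_lintegral_of_nonneg_ae (ae_of_all _ fun x => (prod_pow_mem_Icc hu x).1)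
    (Measurable.of_discrete).aestronglyMeasurable,
    integral_eq_lintegral_of_nonneg_ae (ae_of_all _ fun x => (prod_pow_mem_Icc hu x).1)
    (Measurable.of_discrete).aestronglyMeasurable]
  simp_rw [hconv]
  rw [h u hu]

theorem lintegral_prod_pow_pi_poissonMeasure {ι : Type*} [Fintype ι] (r : ι → NNReal) {u : ι → ℝ}
    (hu : ∀ i, 0 ≤ u i) :
    ∫⁻ x, ∏ i, ENNReal.ofReal (u i) ^ x i ∂(Measure.pi fun i => poissonMeasure (r i)) =
      ENNReal.ofReal (Real.exp (-∑ i, (1 - u i) * r i)) := by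
  have hind := iIndepFun_pi (μ := fun i => poissonMeasure (r i))
    (X := fun i (n : ℕ) => ENNReal.ofReal (u i) ^ n) fun i => (Measurable.of_discrete).aemeasurable
  rw [lintegral_prod_eq_prod_lintegral_of_indepFun _ _ hind
    fun i => Measurable.comp (g := fun n : ℕ => ENNReal.ofReal (u i) ^ n) .of_discrete
      (measurable_pi_apply i), ← Finset.sum_neg_distrib, Real.exp_sum,
    ENNReal.ofReal_prod_of_nonneg fun i _ => (Real.exp_pos _).le]
  refine Finset.prod_congr rfl fun i _ => ?_
  rw [← lintegral_pow_poissonMeasure _ (hu i),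
    ← (measurePreserving_eval (fun i => poissonMeasure (r i)) i).map_eq,
    lintegral_map (.of_discrete) (measurable_pi_apply i)]

/-! ### Averaging over independent marks. -/

section Marking

variable {Ω E F : Type*} [MeasurableSpace Ω] [MeasurableSpace E] [MeasurableSpace F]
  {μ : Measure Ω} [IsProbabilityMeasure μ] {A : ℕ → Ω → F} {S : ℕ → Ω → E}
  {D : Measure E} [IsProbabilityMeasure D]

/-- Integrating out i.i.d. marks that are independent of the points. -/
theorem lintegral_prod_range_mark (hA : ∀ n, Measurable (A n)) (hS : ∀ n, Measurable (S n))
    (hlaw : ∀ n, μ.map (S n) = D) (hSi : iIndepFun S μ)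
    (hind : IndepFun (fun ω n => A n ω) (fun ω n => S n ω) μ)
    {H : F × E → ℝ≥0∞} (hH : Measurable H) (N : ℕ) :
    ∫⁻ ω, ∏ n ∈ Finset.range N, H (A n ω, S n ω) ∂μ =
      ∫⁻ ω, ∏ n ∈ Finset.range N, ∫⁻ s, H (A n ω, s) ∂D ∂μ := by
  have hA' : Measurable fun ω n => A n ω := measurable_pi_lambda _ hA
  have hS' : Measurable fun ω n => S n ω := measurable_pi_lambda _ hS
  have hG : Measurable fun p : (ℕ → F) × (ℕ → E) => ∏ n ∈ Finset.range N, H (p.1 n, p.2 n) :=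
    Finset.measurable_fun_prod _ fun n _ => by fun_prop
  have hjoint := (indepFun_iff_map_prod_eq_prod_map_map hA'.aemeasurable hS'.aemeasurable).1 hind
  have : IsProbabilityMeasure (μ.map fun ω n => S n ω) :=
    Measure.isProbabilityMeasure_map hS'.aemeasurable
  -- Independence makes the joint law of the two sequences a product. Tonelli then freezes the
  -- points, after which the factors are independent functions of the marks.
  calc ∫⁻ ω, ∏ n ∈ Finset.range N, H (A n ω, S n ω) ∂μ
      = ∫⁻ p, ∏ n ∈ Finset.range N, H (p.1 n, p.2 n)
          ∂(μ.map fun ω => ((fun n => A n ω), (fun n => S n ω))) :=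
        (lintegral_map hG (hA'.prodMk hS')).symm
    _ = ∫⁻ a, ∫⁻ s, ∏ n ∈ Finset.range N, H (a n, s n) ∂(μ.map fun ω n => S n ω)
          ∂(μ.map fun ω n => A n ω) := by
        rw [hjoint, lintegral_prod _ hG.aemeasurable]
    _ = ∫⁻ a, ∏ n ∈ Finset.range N, ∫⁻ s, H (a n, s) ∂D ∂(μ.map fun ω n => A n ω) := by
        refine lintegral_congr fun a => ?_
        have hHs : ∀ n, Measurable fun s => H (a n, s) := fun n => hH.comp measurable_prodMk_left
        have hGa : Measurable fun s : ℕ → E => ∏ n ∈ Finset.range N, H (a n, s n) :=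
          hG.comp measurable_prodMk_left
        rw [lintegral_map hGa hS']
        have hi := hSi.comp (fun n s => H (a n, s)) hHs
        refine (lintegral_prod_eq_prod_lintegral_of_indepFun _ _ hi
          fun n => (hHs n).comp (hS n)).trans (Finset.prod_congr rfl fun n _ => ?_)
        rw [← hlaw n, lintegral_map (hHs n) (hS n)]
        rfl
    _ = ∫⁻ ω, ∏ n ∈ Finset.range N, ∫⁻ s, H (A n ω, s) ∂D ∂μ := by
        rw [lintegral_map _ hA']
        exact Finset.measurable_fun_prod _ fun n _ =>
          hH.lintegral_prod_right'.comp (measurable_pi_apply n)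

/-- Factors at most `1` make the partial products decreasing and bounded, so the finite identity
passes to the infimum. -/
theorem lintegral_infProd_mark (hA : ∀ n, Measurable (A n)) (hS : ∀ n, Measurable (S n))
    (hlaw : ∀ n, μ.map (S n) = D) (hSi : iIndepFun S μ)
    (hind : IndepFun (fun ω n => A n ω) (fun ω n => S n ω) μ)
    {H : F × E → ℝ≥0∞} (hH : Measurable H) (hH1 : ∀ p, H p ≤ 1) :
    ∫⁻ ω, infProd (fun n => H (A n ω, S n ω)) ∂μ =
      ∫⁻ ω, infProd (fun n => ∫⁻ s, H (A n ω, s) ∂D) ∂μ := by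
  have h1 : ∀ a, ∫⁻ s, H (a, s) ∂D ≤ 1 := fun a =>
    (lintegral_mono fun s => hH1 (a, s)).trans (by simp)
  simp only [infProd]
  rw [lintegral_iInf, lintegral_iInf]
  · simp_rw [lintegral_prod_range_mark hA hS hlaw hSi hind hH]
  · exact fun N => Finset.measurable_fun_prod _ fun n _ => hH.lintegral_prod_right'.comp (hA n)
  · exact fun i j hij ω => antitone_prod_range (fun n => h1 _) hij
  · simp
  · exact fun N => Finset.measurable_fun_prod _ fun n _ => hH.comp ((hA n).prodMk (hS n))
  · exact fun i j hij ω => antitone_prod_range (fun n => hH1 _) hij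
  · simp

end Marking

/-! ### Counts of a marked Poisson process in disjoint sets. -/

namespace MobileNetwork

variable {Ω E : Type*} [MeasurableSpace Ω] [MeasurableSpace E]
  {μ : Measure Ω} [IsProbabilityMeasure μ] {rate : ℝ} {A : ℕ → Ω → ℝ} {S : ℕ → Ω → E}
  {D : Measure E} [IsProbabilityMeasure D]

/-- Mean number of marked points in `C`, per unit of the rate. -/
noncomputable def markedMass (D : Measure E) (C : Set (ℝ × E)) : ℝ≥0∞ :=
  ∫⁻ a, D {s | (a, s) ∈ C}

open Classical in
/-- Joint generating function of the numbers of points of a marked Poisson process in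
disjoint sets. -/
theorem IsPoissonProcess.lintegral_infProd_marked (hA : IsPoissonProcess μ rate A)
    (hrate : 0 ≤ rate) (hS : ∀ n, Measurable (S n))
    (hlaw : ∀ n, μ.map (S n) = D) (hSi : iIndepFun S μ)
    (hind : IndepFun (fun ω n => A n ω) (fun ω n => S n ω) μ)
    {ι : Type*} [Fintype ι] {C : ι → Set (ℝ × E)} (hC : ∀ i, MeasurableSet (C i))
    (hdisj : ∀ a, ∀ᵐ s ∂D, ∀ i j, (a, s) ∈ C i → (a, s) ∈ C j → i = j)
    (hfin : ∀ i, markedMass D (C i) ≠ ∞) {u : ι → ℝ} (hu : ∀ i, u i ∈ Set.Icc (0 : ℝ) 1) :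
    ∫⁻ ω, infProd (fun n => ∏ i, if (A n ω, S n ω) ∈ C i then ENNReal.ofReal (u i) else 1) ∂μ =
      ENNReal.ofReal (Real.exp (-∑ i, (1 - u i) * (rate * (markedMass D (C i)).toReal))) := by
  set H : ℝ × E → ℝ≥0∞ := fun p => ∏ i, if p ∈ C i then ENNReal.ofReal (u i) else 1 with hHdef
  have hH : Measurable H := Finset.measurable_fun_prod _ fun i _ =>
    Measurable.ite (hC i) measurable_const measurable_const
  have hH1 : ∀ p, H p ≤ 1 := fun p => Finset.prod_le_one' fun i _ => by
    split_ifs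
    · exact ENNReal.ofReal_le_one.2 (hu i).2
    · exact le_rfl
  set v : ℝ → ℝ≥0∞ := fun a => ∑ i, ENNReal.ofReal (1 - u i) * D {s | (a, s) ∈ C i} with hvdef
  have hCa : ∀ i a, MeasurableSet {s | (a, s) ∈ C i} := fun i a => measurable_prodMk_left (hC i)
  have hDm : ∀ i, Measurable fun a => D {s | (a, s) ∈ C i} := fun i =>
    measurable_measure_prodMk_left (hC i)
  have hvm : Measurable v := Finset.measurable_fun_sum _ fun i _ => (hDm i).const_mul _
  -- Almost every mark puts `(a, s)` in at most one `C i`, so at most one factor of `H` differs from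
  -- `1` and the defect `1 - H` is additive over `i`.
  have hHv : ∀ a, ∫⁻ s, 1 - H (a, s) ∂D = v a := by
    intro a
    have : ∀ᵐ s ∂D, 1 - H (a, s) =
        ∑ i, if (a, s) ∈ C i then ENNReal.ofReal (1 - u i) else 0 := by
      filter_upwards [hdisj a] with s hs
      by_cases h : ∃ i, (a, s) ∈ C i
      · obtain ⟨i, hi⟩ := h
        have hne : ∀ j, j ≠ i → (a, s) ∉ C j := fun j hj hjs => hj (hs j i hjs hi)
        rw [hHdef]
        simp only
        rw [Finset.prod_eq_single i (fun j _ hj => if_neg (hne j hj)) (by simp), if_pos hi,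
          Finset.sum_eq_single i (fun j _ hj => if_neg (hne j hj)) (by simp), if_pos hi,
          ENNReal.ofReal_sub _ (hu i).1, ENNReal.ofReal_one]
      · push Not at h
        rw [hHdef]
        simp only
        rw [Finset.prod_eq_one fun j _ => if_neg (h j),
          Finset.sum_eq_zero fun j _ => if_neg (h j), tsub_self]
    rw [lintegral_congr_ae this, lintegral_finsetSum]
    · refine Finset.sum_congr rfl fun i _ => ?_
      rw [← lintegral_indicator_const (hCa i a)]
      exact lintegral_congr fun s => by simp [Set.indicator]
    · exact fun i _ => Measurable.ite (hCa i a) measurable_const measurable_const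
  have hv1 : ∀ a, v a ≤ 1 := fun a => by
    rw [← hHv]
    exact (lintegral_mono fun s => tsub_le_self).trans (by simp)
  have hg : ∀ a, ∫⁻ s, H (a, s) ∂D = 1 - v a := by
    intro a
    have hle : ∫⁻ s, H (a, s) ∂D ≤ 1 := (lintegral_mono fun s => hH1 (a, s)).trans (by simp)
    have hHs : Measurable fun s => H (a, s) := hH.comp measurable_prodMk_left
    rw [← hHv, lintegral_sub hHs
      (ne_top_of_le_ne_top ENNReal.one_ne_top hle) (ae_of_all _ fun s => hH1 _)]
    simp only [lintegral_const, measure_univ, mul_one]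
    exact (ENNReal.sub_sub_cancel ENNReal.one_ne_top hle).symm
  have hvint : ∫⁻ a, v a = ∑ i, ENNReal.ofReal (1 - u i) * markedMass D (C i) := by
    rw [lintegral_finsetSum _ fun i _ => (hDm i).const_mul _]
    exact Finset.sum_congr rfl fun i _ => lintegral_const_mul _ (hDm i)
  have hterm : ∀ i, ENNReal.ofReal (1 - u i) * markedMass D (C i) ≠ ∞ := fun i =>
    ENNReal.mul_ne_top ENNReal.ofReal_ne_top (hfin i)
  rw [lintegral_infProd_mark hA.measurable hS hlaw hSi hind hH hH1]
  simp_rw [hg]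
  rw [hA.lintegral_infProd hrate hvm hv1 (by rw [hvint]; exact ENNReal.sum_ne_top.2 fun i _ => hterm i),
    hvint, ENNReal.toReal_sum fun i _ => hterm i, Finset.mul_sum]
  congr 3
  refine Finset.sum_congr rfl fun i _ => ?_
  rw [ENNReal.toReal_mul, ENNReal.toReal_ofReal (sub_nonneg.2 (hu i).2)]
  ring

/-- `C` may involve arrival times in a set of infinite length, so finiteness does not follow from
the unmarked counts. For `u < 1` the infinite product vanishes when the count is infinite, hence its
mean is at most the probability of a finite count; letting `u → 1` makes that mean tend to `1`. -/
theorem IsPoissonProcess.ae_finite_marked (hA : IsPoissonProcess μ rate A)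
    (hrate : 0 ≤ rate) (hS : ∀ n, Measurable (S n))
    (hlaw : ∀ n, μ.map (S n) = D) (hSi : iIndepFun S μ)
    (hind : IndepFun (fun ω n => A n ω) (fun ω n => S n ω) μ)
    {C : Set (ℝ × E)} (hC : MeasurableSet C) (hfin : markedMass D C ≠ ∞) :
    ∀ᵐ ω ∂μ, {n | (A n ω, S n ω) ∈ C}.Finite := by
  classical
  have hmeas : MeasurableSet {ω | {n | (A n ω, S n ω) ∈ C}.Finite} := by
    simp_rw [← Set.encard_ne_top_iff]
    exact (measurable_encard_setOf fun n => ((hA.measurable n).prodMk (hS n)) hC)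
      (measurableSet_singleton _).compl
  set u : ℕ → ℝ := fun k => 1 - 1 / ((k : ℝ) + 1) with hudef
  have hu : ∀ k, u k ∈ Set.Ico (0 : ℝ) 1 := fun k =>
    ⟨sub_nonneg.2 ((div_le_one (by positivity)).2 (by simp)), sub_lt_self _ (by positivity)⟩
  have hb : ∀ k, ENNReal.ofReal (Real.exp (-((1 - u k) * (rate * (markedMass D C).toReal)))) ≤
      μ {ω | {n | (A n ω, S n ω) ∈ C}.Finite} := by
    intro k
    have h := hA.lintegral_infProd_marked hrate hS hlaw hSi hind (ι := Unit) (C := fun _ => C)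
      (fun _ => hC) (fun _ => ae_of_all _ fun _ _ _ _ _ => rfl) (fun _ => hfin)
      (u := fun _ => u k) (fun _ => ⟨(hu k).1, (hu k).2.le⟩)
    simp only [Finset.univ_unique, Finset.prod_singleton, Finset.sum_singleton] at h
    rw [← h, ← lintegral_indicator_one hmeas]
    refine lintegral_mono fun ω => ?_
    by_cases hω : {n | (A n ω, S n ω) ∈ C}.Finite
    · rw [Set.indicator_of_mem
        (show ω ∈ {ω | {n | (A n ω, S n ω) ∈ C}.Finite} from hω)]
      exact infProd_le_one _
    · exact (infProd_ite_mem_of_infinite (I := {n | (A n ω, S n ω) ∈ C}) hω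
        (ENNReal.ofReal_lt_one.2 (hu k).2)).trans_le bot_le
  have hlim : Tendsto (fun k => ENNReal.ofReal
      (Real.exp (-((1 - u k) * (rate * (markedMass D C).toReal))))) atTop (𝓝 1) := by
    have h0 : Tendsto (fun k => 1 - u k) atTop (𝓝 0) := by
      simpa [hudef] using tendsto_one_div_add_atTop_nhds_zero_nat (𝕜 := ℝ)
    have h1 := (h0.mul_const (rate * (markedMass D C).toReal)).neg
    rw [zero_mul, neg_zero] at h1
    have h2 := (ENNReal.continuous_ofReal.tendsto _).comp ((Real.continuous_exp.tendsto _).comp h1)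
    rwa [Real.exp_zero, ENNReal.ofReal_one] at h2
  exact (prob_compl_eq_zero_iff hmeas).2 (le_antisymm prob_le_one (le_of_tendsto' hlim hb))

/-- The numbers of points of a marked Poisson process in disjoint sets are independent and Poisson
distributed. -/
theorem IsPoissonProcess.measure_encard_marked_eq (hA : IsPoissonProcess μ rate A)
    (hrate : 0 ≤ rate) (hS : ∀ n, Measurable (S n))
    (hlaw : ∀ n, μ.map (S n) = D) (hSi : iIndepFun S μ)
    (hind : IndepFun (fun ω n => A n ω) (fun ω n => S n ω) μ)
    {ι : Type*} [Fintype ι] {C : ι → Set (ℝ × E)} (hC : ∀ i, MeasurableSet (C i))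
    (hdisj : ∀ a, ∀ᵐ s ∂D, ∀ i j, (a, s) ∈ C i → (a, s) ∈ C j → i = j)
    (hfin : ∀ i, markedMass D (C i) ≠ ∞) (x : ι → ℕ) :
    μ {ω | ∀ i, {n | (A n ω, S n ω) ∈ C i}.encard = x i} =
      ∏ i, poissonMeasure (rate * (markedMass D (C i)).toReal).toNNReal {x i} := by
  classical
  have hfinite : ∀ᵐ ω ∂μ, ∀ i, {n | (A n ω, S n ω) ∈ C i}.Finite :=
    ae_all_iff.2 fun i => hA.ae_finite_marked hrate hS hlaw hSi hind (hC i) (hfin i)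
  -- `toNat` sends an infinite count to `0`, which matters only on the null set excluded by
  -- `hfinite`.
  set Y : Ω → ι → ℕ := fun ω i => {n | (A n ω, S n ω) ∈ C i}.encard.toNat with hY
  have hYm : Measurable Y := measurable_pi_lambda _ fun i =>
    Measurable.comp (g := ENat.toNat) .of_discrete
      (measurable_encard_setOf fun n => ((hA.measurable n).prodMk (hS n)) (hC i))
  have : IsProbabilityMeasure (μ.map Y) := Measure.isProbabilityMeasure_map hYm.aemeasurable
  have hYlaw : μ.map Y = Measure.pi fun i =>
      poissonMeasure (rate * (markedMass D (C i)).toReal).toNNReal := by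
    refine ext_of_lintegral_prod_pow fun u hu => ?_
    rw [lintegral_prod_pow_pi_poissonMeasure _ fun i => (hu i).1,
      lintegral_map (.of_discrete) hYm]
    have hr : ∀ i, (((rate * (markedMass D (C i)).toReal).toNNReal : NNReal) : ℝ) =
        rate * (markedMass D (C i)).toReal := fun i => Real.coe_toNNReal _ (by positivity)
    simp_rw [hr]
    rw [← hA.lintegral_infProd_marked hrate hS hlaw hSi hind hC hdisj hfin hu]
    refine lintegral_congr_ae ?_
    filter_upwards [hfinite] with ω hω
    symm
    exact infProd_prod_ite_mem (I := fun i => {n | (A n ω, S n ω) ∈ C i}) hω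
      fun i => ENNReal.ofReal_le_one.2 (hu i).2
  rw [← Measure.pi_singleton, ← hYlaw, Measure.map_apply hYm (measurableSet_singleton x)]
  refine measure_congr ?_
  filter_upwards [hfinite] with ω hω
  refine propext ⟨fun h => funext fun i => ?_, fun h i => ?_⟩
  · have := h i
    simp [hY, this]
  · have hi : Y ω i = x i := congrFun h i
    rw [← hi, hY]
    exact (ENat.natCast_toNat (Set.encard_ne_top_iff.2 (hω i))).symm

end MobileNetwork

/-! ### A single session: presence sets, mean occupancy and ending probabilities. -/

namespace MobileNetwork

section Session

variable {n : ℕ}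

@[fun_prop]
theorem measurable_entryTime (j : Fin n) : Measurable fun s : Session n => entryTime s j :=
  Finset.measurable_fun_sum _ fun i _ => by fun_prop

@[fun_prop]
theorem measurable_holdingTime (j : Fin n) : Measurable fun s : Session n => holdingTime s j :=
  (measurable_fst.sub (measurable_entryTime j)).min (by fun_prop)

theorem measurableSet_reaches (j : Fin n) : MeasurableSet {s : Session n | Reaches s j} :=
  measurableSet_lt (measurable_entryTime j) measurable_fst

/-- The pairs (arrival time, session) that are counted in stage `j` at time `t`. -/
def presentSet (n : ℕ) (W : Set ℝ) (t : ℝ) (j : Fin n) : Set (ℝ × Session n) :=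
  {p | p.1 ∈ W ∧ InStage p.2 j (t - p.1)}

theorem measurableSet_presentSet {W : Set ℝ} (hW : MeasurableSet W) (t : ℝ) (j : Fin n) :
    MeasurableSet (presentSet n W t j) := by
  have he : Measurable fun p : ℝ × Session n => entryTime p.2 j :=
    (measurable_entryTime j).comp measurable_snd
  have hh : Measurable fun p : ℝ × Session n => holdingTime p.2 j :=
    (measurable_holdingTime j).comp measurable_snd
  have ha : Measurable fun p : ℝ × Session n => t - p.1 := measurable_const.sub measurable_fst
  exact (measurable_fst hW).inter ((measurable_snd (measurableSet_reaches j)).inter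
    ((measurableSet_le he ha).inter (measurableSet_lt ha (he.add hh))))

/-- Nonnegative dwell times order the stages in time; the disjointness of the presence sets rests on
this. -/
theorem entryTime_add_le {s : Session n} (hs : ∀ j, 0 ≤ s.2 j) {i j : Fin n} (hij : i < j) :
    entryTime s i + s.2 i ≤ entryTime s j := by
  rw [entryTime, add_comm, ← Finset.sum_insert (by simp), Finset.Iio_insert]
  exact Finset.sum_le_sum_of_subset_of_nonneg
    (fun k hk => Finset.mem_Iio.2 ((Finset.mem_Iic.1 hk).trans_lt hij)) fun k _ _ => hs k

theorem InStage.not_of_lt {s : Session n} (hs : ∀ j, 0 ≤ s.2 j) {i j : Fin n} (hij : i < j) {a : ℝ}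
    (hi : InStage s i a) : ¬ InStage s j a := fun hj => by
  have h1 := entryTime_add_le hs hij
  have h2 : holdingTime s i ≤ s.2 i := min_le_right _ _
  linarith [hi.2.2, hj.2.1]

theorem InStage.eq {s : Session n} (hs : ∀ j, 0 ≤ s.2 j) {i j : Fin n} {a : ℝ}
    (hi : InStage s i a) (hj : InStage s j a) : i = j := by
  rcases lt_trichotomy i j with h | h | h
  · exact absurd hj (hi.not_of_lt hs h)
  · exact h
  · exact absurd hi (hj.not_of_lt hs h)

/-- Source of the insensitivity: for `W = Set.univ` the length of this set is the holding time,
independently of `t` and of the entry time. -/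
theorem setOf_mem_presentSet_of_reaches {s : Session n} {j : Fin n} (hs : Reaches s j) (W : Set ℝ)
    (t : ℝ) : {a | (a, s) ∈ presentSet n W t j} =
      W ∩ Set.Ioc (t - (entryTime s j + holdingTime s j)) (t - entryTime s j) := by
  ext a
  simp only [presentSet, InStage, hs, true_and, Set.mem_ofPred_eq, Set.mem_inter_iff, Set.mem_Ioc]
  refine and_congr_right fun _ => ⟨fun h => ⟨by linarith [h.2], by linarith [h.1]⟩,
    fun h => ⟨by linarith [h.2], by linarith [h.1]⟩⟩

theorem setOf_mem_presentSet_of_not_reaches {s : Session n} {j : Fin n} (hs : ¬ Reaches s j)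
    (W : Set ℝ) (t : ℝ) : {a | (a, s) ∈ presentSet n W t j} = ∅ := by
  ext a
  simp [presentSet, InStage, hs]

variable {D : Measure (Session n)}

/-- Probability that a session lasts more than `k` stages. -/
def reachProb (D : Measure (Session n)) (k : ℕ) : ℝ :=
  if h : k < n then D.real {s | Reaches s ⟨k, h⟩} else 0

theorem reachProb_val (j : Fin n) : reachProb D j = D.real {s | Reaches s j} := by
  simp [reachProb]

variable [IsProbabilityMeasure D]

/-- Tonelli: the arrival time is integrated first, with the session fixed. -/
theorem markedMass_presentSet {W : Set ℝ} (hW : MeasurableSet W) (t : ℝ) (j : Fin n) :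
    markedMass D (presentSet n W t j) = ∫⁻ s in {s | Reaches s j},
      volume (W ∩ Set.Ioc (t - (entryTime s j + holdingTime s j)) (t - entryTime s j)) ∂D := by
  have h := measurableSet_presentSet hW t j
  have h1 : markedMass D (presentSet n W t j) = (volume.prod D) (presentSet n W t j) :=
    (Measure.prod_apply h).symm
  rw [h1, Measure.prod_apply_symm h, ← lintegral_indicator (measurableSet_reaches j)]
  refine lintegral_congr fun s => ?_
  change volume {a | (a, s) ∈ presentSet n W t j} = _
  by_cases hs : Reaches s j
  · rw [setOf_mem_presentSet_of_reaches hs, Set.indicator_of_mem (by exact hs)]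
  · rw [setOf_mem_presentSet_of_not_reaches hs, Set.indicator_of_notMem (by exact hs),
      measure_empty]

theorem lintegral_holdingTime_eq (hdwell : ∀ᵐ s ∂D, ∀ j, 0 ≤ s.2 j) (j : Fin n)
    (hreach : 0 < D.real {s | Reaches s j})
    (hint : Integrable (fun s => holdingTime s j) (cond D {s | Reaches s j})) :
    ∫⁻ s in {s | Reaches s j}, ENNReal.ofReal (holdingTime s j) ∂D =
      ENNReal.ofReal (D.real {s | Reaches s j} * meanHoldingTime D j) := by
  have hR : D {s | Reaches s j} ≠ 0 := fun h => by simp [Measure.real, h] at hreach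
  have hnn : 0 ≤ᵐ[cond D {s | Reaches s j}] fun s => holdingTime s j := by
    have h1 : ∀ᵐ s ∂(cond D {s | Reaches s j}), ∀ j, 0 ≤ s.2 j :=
      cond_absolutelyContinuous.ae_le hdwell
    have h2 : ∀ᵐ s ∂(cond D {s | Reaches s j}), Reaches s j :=
      ae_cond_mem (measurableSet_reaches j)
    filter_upwards [h1, h2] with s hs hr
    exact le_min (sub_nonneg.2 (le_of_lt hr)) (hs j)
  rw [meanHoldingTime, ENNReal.ofReal_mul measureReal_nonneg,
    ofReal_integral_eq_lintegral_ofReal hint hnn, ofReal_measureReal, ProbabilityTheory.cond,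
    lintegral_smul_measure, smul_eq_mul, ← mul_assoc,
    ENNReal.mul_inv_cancel hR (measure_ne_top _ _), one_mul]

theorem markedMass_presentSet_univ (hdwell : ∀ᵐ s ∂D, ∀ j, 0 ≤ s.2 j) (t : ℝ) (j : Fin n)
    (hreach : 0 < D.real {s | Reaches s j})
    (hint : Integrable (fun s => holdingTime s j) (cond D {s | Reaches s j})) :
    markedMass D (presentSet n Set.univ t j) =
      ENNReal.ofReal (D.real {s | Reaches s j} * meanHoldingTime D j) := by
  rw [markedMass_presentSet MeasurableSet.univ, ← lintegral_holdingTime_eq hdwell j hreach hint]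
  refine lintegral_congr fun s => ?_
  rw [Set.univ_inter, Real.volume_Ioc]
  congr 1
  ring

theorem markedMass_presentSet_ne_top (hdwell : ∀ᵐ s ∂D, ∀ j, 0 ≤ s.2 j) (W : Set ℝ) (t : ℝ)
    (j : Fin n) (hreach : 0 < D.real {s | Reaches s j})
    (hint : Integrable (fun s => holdingTime s j) (cond D {s | Reaches s j})) :
    markedMass D (presentSet n W t j) ≠ ∞ := by
  refine ne_top_of_le_ne_top (b := markedMass D (presentSet n Set.univ t j)) ?_
    (lintegral_mono fun a => measure_mono fun s hs => ⟨trivial, hs.2⟩)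
  rw [markedMass_presentSet_univ hdwell t j hreach hint]
  exact ENNReal.ofReal_ne_top

/-- For each session the window of arrival times lies in `[0, ∞)` once `t` exceeds the exit time
from stage `j`. The holding time dominates and is integrable on the event that `j` is reached. -/
theorem tendsto_markedMass_presentSet_Ici (hdwell : ∀ᵐ s ∂D, ∀ j, 0 ≤ s.2 j) (j : Fin n)
    (hreach : 0 < D.real {s | Reaches s j})
    (hint : Integrable (fun s => holdingTime s j) (cond D {s | Reaches s j})) :
    Tendsto (fun t => markedMass D (presentSet n (Set.Ici 0) t j)) atTop
      (𝓝 (ENNReal.ofReal (D.real {s | Reaches s j} * meanHoldingTime D j))) := by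
  have hvol : ∀ (t : ℝ) (s : Session n),
      volume (Set.Ioc (t - (entryTime s j + holdingTime s j)) (t - entryTime s j)) =
        ENNReal.ofReal (holdingTime s j) := fun t s => by
    rw [Real.volume_Ioc]; congr 1; ring
  have hlint := lintegral_holdingTime_eq hdwell j hreach hint
  rw [← hlint]
  have hmm := fun t => markedMass_presentSet (D := D) (measurableSet_Ici (a := (0 : ℝ))) t j
  simp_rw [hmm]
  refine tendsto_lintegral_filter_of_dominated_convergence
    (fun s => ENNReal.ofReal (holdingTime s j)) (Eventually.of_forall fun t => ?_)
    (Eventually.of_forall fun t => ae_of_all _ fun s => ?_) (by rw [hlint]; exact ENNReal.ofReal_ne_top)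
    (ae_of_all _ fun s => ?_)
  · have h : Measurable fun s : Session n =>
        volume (Set.Ici 0 ∩ Set.Ioc (t - (entryTime s j + holdingTime s j)) (t - entryTime s j)) := by
      have h2 : MeasurableSet {p : Session n × ℝ | p.2 ∈ Set.Ici (0 : ℝ) ∩
          Set.Ioc (t - (entryTime p.1 j + holdingTime p.1 j)) (t - entryTime p.1 j)} := by
        have he : Measurable fun p : Session n × ℝ => entryTime p.1 j :=
          (measurable_entryTime j).comp measurable_fst
        have hh : Measurable fun p : Session n × ℝ => holdingTime p.1 j :=
          (measurable_holdingTime j).comp measurable_fst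
        exact (measurable_snd measurableSet_Ici).inter
          ((measurableSet_lt (measurable_const.sub (he.add hh)) measurable_snd).inter
            (measurableSet_le measurable_snd (measurable_const.sub he)))
      exact measurable_measure_prodMk_left h2
    exact h
  · rw [← hvol t s]
    exact measure_mono Set.inter_subset_right
  · refine tendsto_const_nhds.congr' ?_
    filter_upwards [eventually_ge_atTop (entryTime s j + holdingTime s j)] with t ht
    rw [Set.inter_eq_right.2, hvol]
    intro a ha
    exact (sub_nonneg.2 ht).trans ha.1.le

theorem reachProb_zero (hduration : ∀ᵐ s ∂D, 0 < s.1) (hn : 0 < n) : reachProb D 0 = 1 := by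
  rw [reachProb, dif_pos hn]
  have h : ∀ᵐ s ∂D, s ∈ {s : Session n | Reaches s ⟨0, hn⟩} := by
    filter_upwards [hduration] with s hs
    have : Finset.Iio (⟨0, hn⟩ : Fin n) = ∅ := by ext i; simp [Fin.lt_def]
    simpa [Reaches, entryTime, this] using hs
  rw [measureReal_def, (mem_ae_iff_prob_eq_one (measurableSet_reaches _)).1 h, ENNReal.toReal_one]

/-- Ending in stage `j` means reaching `j` but not `j + 1`; the reach events are nested almost
surely because dwell times are nonnegative. The default `reachProb D n = 0` covers the last stage,
so sums of ending probabilities telescope. -/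
theorem endProb_eq (hdwell : ∀ᵐ s ∂D, ∀ j, 0 ≤ s.2 j) (j : Fin n) :
    endProb D j = reachProb D j - reachProb D (j + 1) := by
  rw [reachProb_val, reachProb, endProb]
  split_ifs with h
  · set k : Fin n := ⟨j + 1, h⟩ with hk
    have hjk : j < k := Fin.lt_def.2 (Nat.lt_succ_self _)
    have hIic : Finset.Iic j = Finset.Iio k := by
      ext i
      rw [Finset.mem_Iic, Finset.mem_Iio, Fin.le_def, Fin.lt_def]
      exact Nat.lt_succ_iff.symm
    have hset : {s : Session n | EndsInStage s j} =
        {s | Reaches s j} \ {s | Reaches s k} := by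
      ext s
      simp [EndsInStage, Reaches, entryTime, h, hIic]
    rw [hset, ← measureReal_inter_add_sdiff (s := {s : Session n | Reaches s j}) (measurableSet_reaches k)]
    have : ({s : Session n | Reaches s j} ∩ {s | Reaches s k} : Set (Session n)) =ᵐ[D]
        {s | Reaches s k} := by
      filter_upwards [hdwell] with s hs
      refine propext ⟨fun h => h.2, fun h => ⟨?_, h⟩⟩
      exact lt_of_le_of_lt (by linarith [entryTime_add_le hs hjk, hs j] :
        entryTime s j ≤ entryTime s k) h
    rw [measureReal_congr this]
    ring
  · rw [sub_zero]
    congr 1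
    ext s
    simp [EndsInStage, Reaches, entryTime, h]

theorem sum_Iio_endProb (hduration : ∀ᵐ s ∂D, 0 < s.1) (hdwell : ∀ᵐ s ∂D, ∀ j, 0 ≤ s.2 j)
    (j : Fin n) : ∑ i ∈ Finset.Iio j, endProb D i = 1 - reachProb D j := by
  have h := Finset.sum_map (Finset.Iio j) Fin.valEmbedding
    fun k => reachProb D k - reachProb D (k + 1)
  rw [Fin.map_valEmbedding_Iio, Nat.Iio_eq_range, Finset.sum_range_sub',
    reachProb_zero hduration (j.pos)] at h
  rw [h]
  exact Finset.sum_congr rfl fun i _ => endProb_eq hdwell i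

theorem sum_endProb (hduration : ∀ᵐ s ∂D, 0 < s.1) (hdwell : ∀ᵐ s ∂D, ∀ j, 0 ≤ s.2 j)
    (hn : 0 < n) : ∑ i, endProb D i = 1 := by
  have h := Fin.sum_univ_eq_sum_range (fun k => reachProb D k - reachProb D (k + 1)) n
  rw [Finset.sum_range_sub', reachProb_zero hduration hn] at h
  simp_rw [endProb_eq hdwell, h]
  simp [reachProb]

theorem sum_Ici_endProb (hduration : ∀ᵐ s ∂D, 0 < s.1) (hdwell : ∀ᵐ s ∂D, ∀ j, 0 ≤ s.2 j)
    (j : Fin n) : ∑ i ∈ Finset.Ici j, endProb D i = reachProb D j := by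
  have h := Finset.sum_compl_add_sum (Finset.Iio j) (endProb D)
  have hc : (Finset.Iio j)ᶜ = Finset.Ici j := by ext; simp
  rw [hc, sum_endProb hduration hdwell j.pos, sum_Iio_endProb hduration hdwell] at h
  linarith

theorem sum_Ioi_endProb (hduration : ∀ᵐ s ∂D, 0 < s.1) (hdwell : ∀ᵐ s ∂D, ∀ j, 0 ≤ s.2 j)
    (j : Fin n) : ∑ i ∈ Finset.Ioi j, endProb D i = reachProb D (j + 1) := by
  have h := sum_Ici_endProb hduration hdwell j
  rw [← Finset.Ioi_insert, Finset.sum_insert (by simp), endProb_eq hdwell] at h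
  linarith

theorem offeredLoad_eq (hduration : ∀ᵐ s ∂D, 0 < s.1) (hdwell : ∀ᵐ s ∂D, ∀ j, 0 ≤ s.2 j)
    (lam0 : ℝ) (j : Fin n) :
    offeredLoad lam0 D j = lam0 * (D.real {s | Reaches s j} * meanHoldingTime D j) := by
  rw [offeredLoad, sum_Iio_endProb hduration hdwell, serviceRate, reachProb_val]
  simp [mul_assoc]

end Session

/-! ### The law of the occupancy vector. -/

theorem continuous_poissonMeasure_singleton (k : ℕ) :
    Continuous fun r : ℝ => poissonMeasure r.toNNReal {k} := by
  simp_rw [poissonMeasure_singleton]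
  refine ENNReal.continuous_ofReal.comp ?_
  have : Continuous fun r : ℝ => ((r.toNNReal : NNReal) : ℝ) := by fun_prop
  fun_prop

section Network

variable {L : ℕ} {N : Fin L → ℕ} {lam0 : Fin L → ℝ} {D : ∀ l : Fin L, Measure (Session (N l))}

/-- The product of the Poisson laws with the offered loads as means. -/
noncomputable def poissonState (lam0 : Fin L → ℝ) (D : ∀ l : Fin L, Measure (Session (N l))) :
    PMF (State N) :=
  (Measure.pi fun q : Σ l, Fin (N l) =>
    poissonMeasure (offeredLoad (lam0 q.1) (D q.1) q.2).toNNReal).toPMF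

theorem poissonState_apply (lam0 : Fin L → ℝ) (D : ∀ l : Fin L, Measure (Session (N l)))
    (x : State N) :
    poissonState lam0 D x = ∏ q : Σ l, Fin (N l),
      poissonMeasure (offeredLoad (lam0 q.1) (D q.1) q.2).toNNReal {x q} := by
  rw [poissonState, Measure.toPMF_apply, Measure.pi_singleton]

theorem poissonState_apply_eq_ofReal (hw : ∀ l j, 0 ≤ offeredLoad (lam0 l) (D l) j)
    (x : State N) :
    poissonState lam0 D x = ENNReal.ofReal (∏ l, ∏ j : Fin (N l),
        Real.exp (-offeredLoad (lam0 l) (D l) j) *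
          offeredLoad (lam0 l) (D l) j ^ x ⟨l, j⟩ / (x ⟨l, j⟩)!) := by
  have hterm : ∀ l j, 0 ≤ Real.exp (-offeredLoad (lam0 l) (D l) j) *
      offeredLoad (lam0 l) (D l) j ^ x ⟨l, j⟩ / (x ⟨l, j⟩)! := fun l j => by
    have := hw l j
    positivity
  rw [poissonState_apply, Fintype.prod_sigma,
    ENNReal.ofReal_prod_of_nonneg fun l _ => Finset.prod_nonneg fun j _ => hterm l j]
  refine Finset.prod_congr rfl fun l _ => ?_
  rw [ENNReal.ofReal_prod_of_nonneg fun j _ => hterm l j]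
  refine Finset.prod_congr rfl fun j _ => ?_
  rw [poissonMeasure_singleton, Real.coe_toNNReal _ (hw l j)]

variable {Ω : Type*} [MeasurableSpace Ω] {μ : Measure Ω} [IsProbabilityMeasure μ]
  [∀ l, IsProbabilityMeasure (D l)] {A : Fin L → ℕ → Ω → ℝ}
  {S : ∀ l : Fin L, ℕ → Ω → Session (N l)}

/-- The occupancies at time `t` are independent and Poisson distributed. -/
theorem IsNetwork.measure_occupancy_eq (hnet : IsNetwork μ lam0 D A S) (hlam0 : ∀ l, 0 < lam0 l)
    (hdwell : ∀ l, ∀ᵐ s ∂(D l), ∀ j, 0 ≤ s.2 j)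
    (hreach : ∀ l j, 0 < (D l).real {s | Reaches s j})
    (hint : ∀ l j, Integrable (fun s => holdingTime s j) (cond (D l) {s | Reaches s j}))
    {W : Set ℝ} (hW : MeasurableSet W) (t : ℝ) (x : State N) :
    μ {ω | ∀ q, occupancy A S W t q ω = x q} =
      ∏ q : Σ l, Fin (N l), poissonMeasure
        (lam0 q.1 * (markedMass (D q.1) (presentSet (N q.1) W t q.2)).toReal).toNNReal {x q} := by
  have hroute : ∀ l, μ {ω | ∀ j, occupancy A S W t ⟨l, j⟩ ω = x ⟨l, j⟩} =
      ∏ j, poissonMeasure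
        (lam0 l * (markedMass (D l) (presentSet (N l) W t j)).toReal).toNNReal {x ⟨l, j⟩} :=
    fun l => (hnet.arrivals l).measure_encard_marked_eq (hlam0 l).le (hnet.measurable l)
      (hnet.session_law l) (hnet.session_indep l) (hnet.arrivals_indep_sessions l)
      (C := presentSet (N l) W t) (fun j => measurableSet_presentSet hW t j)
      (fun a => by
        filter_upwards [hdwell l] with s hs i j hi hj
        exact InStage.eq hs hi.2 hj.2)
      (fun j => markedMass_presentSet_ne_top (hdwell l) W t j (hreach l j) (hint l j))
      (fun j => x ⟨l, j⟩)
  have hset : {ω | ∀ q, occupancy A S W t q ω = x q} =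
      ⋂ l, {ω | ∀ j, occupancy A S W t ⟨l, j⟩ ω = x ⟨l, j⟩} := by
    ext ω
    simp [Sigma.forall]
  rw [hset, hnet.routes_indep.meas_iInter, Fintype.prod_sigma]
  · exact Finset.prod_congr rfl fun l _ => hroute l
  · intro l
    refine ⟨{p | ∀ j, {n | (p.1 n, p.2 n) ∈ presentSet (N l) W t j}.encard = x ⟨l, j⟩}, ?_, rfl⟩
    rw [Set.ofPred_forall]
    refine MeasurableSet.iInter fun j => ?_
    exact (measurable_encard_setOf fun n => measurableSet_preimage
      (f := fun p : (ℕ → ℝ) × (ℕ → Session (N l)) => (p.1 n, p.2 n)) (by fun_prop)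
      (measurableSet_presentSet hW t j)) (measurableSet_singleton _)

end Network

end MobileNetwork

/-! ### Poisson recursion and routing of the memoryless network. -/

theorem poissonMeasure_singleton_succ (r : NNReal) (k : ℕ) :
    poissonMeasure r {k + 1} * ENNReal.ofReal (k + 1) = poissonMeasure r {k} * ENNReal.ofReal r := by
  rw [poissonMeasure_singleton, poissonMeasure_singleton, ← ENNReal.ofReal_mul (by positivity),
    ← ENNReal.ofReal_mul (by positivity)]
  congr 1
  rw [Nat.factorial_succ]
  push_cast
  field_simp
  ring

namespace MobileNetwork

section Routing

variable {n : ℕ} {D : Measure (Session n)}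

theorem serviceRate_pos {j : Fin n} (hmean : 0 < meanHoldingTime D j) : 0 < serviceRate D j :=
  one_div_pos.2 hmean

theorem endProb_nonneg (j : Fin n) : 0 ≤ endProb D j := measureReal_nonneg

theorem advanceProb_nonneg (j : Fin n) : 0 ≤ advanceProb D j :=
  div_nonneg (Finset.sum_nonneg fun i _ => endProb_nonneg i)
    (Finset.sum_nonneg fun i _ => endProb_nonneg i)

theorem exitProb_nonneg (j : Fin n) : 0 ≤ exitProb D j :=
  div_nonneg (endProb_nonneg j) (Finset.sum_nonneg fun i _ => endProb_nonneg i)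

theorem advanceProb_eq_zero {j : Fin n} (hj : ¬ j.val + 1 < n) : advanceProb D j = 0 := by
  have : Finset.Ioi j = ∅ := by
    ext i
    simp only [Finset.mem_Ioi, Finset.notMem_empty, iff_false, Fin.lt_def]
    lia
  rw [advanceProb, this, Finset.sum_empty, zero_div]

variable [IsProbabilityMeasure D]

/-- Solution of the traffic equations: the throughput of queue `j` is the rate of sessions that
reach stage `j`. -/
theorem offeredLoad_mul_serviceRate (hduration : ∀ᵐ s ∂D, 0 < s.1)
    (hdwell : ∀ᵐ s ∂D, ∀ j, 0 ≤ s.2 j) (lam0 : ℝ) {j : Fin n} (hmean : 0 < meanHoldingTime D j) :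
    offeredLoad lam0 D j * serviceRate D j = lam0 * reachProb D j := by
  rw [offeredLoad, sum_Iio_endProb hduration hdwell, div_mul_cancel₀ _ (serviceRate_pos hmean).ne']
  ring

theorem reachProb_mul_advanceProb (hduration : ∀ᵐ s ∂D, 0 < s.1)
    (hdwell : ∀ᵐ s ∂D, ∀ j, 0 ≤ s.2 j) {j : Fin n} (hreach : 0 < D.real {s | Reaches s j}) :
    reachProb D j * advanceProb D j = reachProb D (j + 1) := by
  rw [advanceProb, sum_Ioi_endProb hduration hdwell, sum_Ici_endProb hduration hdwell]
  rw [← reachProb_val] at hreach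
  field_simp

theorem reachProb_mul_exitProb (hduration : ∀ᵐ s ∂D, 0 < s.1)
    (hdwell : ∀ᵐ s ∂D, ∀ j, 0 ≤ s.2 j) {j : Fin n} (hreach : 0 < D.real {s | Reaches s j}) :
    reachProb D j * exitProb D j = endProb D j := by
  rw [exitProb, sum_Ici_endProb hduration hdwell]
  rw [← reachProb_val] at hreach
  field_simp

theorem advanceProb_add_exitProb (hduration : ∀ᵐ s ∂D, 0 < s.1)
    (hdwell : ∀ᵐ s ∂D, ∀ j, 0 ≤ s.2 j) {j : Fin n} (hreach : 0 < D.real {s | Reaches s j}) :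
    advanceProb D j + exitProb D j = 1 := by
  have h1 := reachProb_mul_advanceProb hduration hdwell hreach
  have h2 := reachProb_mul_exitProb hduration hdwell hreach
  rw [endProb_eq hdwell] at h2
  rw [← reachProb_val] at hreach
  refine mul_left_cancel₀ hreach.ne' ?_
  linarith

end Routing

/-! ### Balance equations and irreducibility of the memoryless network. -/

section Memoryless

variable {L : ℕ} {N : Fin L → ℕ} {lam0 : Fin L → ℝ} {D : ∀ l : Fin L, Measure (Session (N l))}

@[simp]
theorem oneUser_apply_self (l : Fin L) (j : Fin (N l)) : oneUser (N := N) l j ⟨l, j⟩ = 1 := by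
  simp [oneUser]

theorem oneUser_apply_of_ne (l : Fin L) {j k : Fin (N l)} (h : k ≠ j) :
    oneUser (N := N) l j ⟨l, k⟩ = 0 :=
  Pi.single_eq_of_ne (fun h' => h (by simpa using h')) _

theorem exists_eq_add_oneUser {x : State N} {l : Fin L} {j : Fin (N l)} (h : x ⟨l, j⟩ ≠ 0) :
    ∃ z : State N, x = z + oneUser l j := by
  refine ⟨x - oneUser l j, funext fun q => ?_⟩
  by_cases hq : q = ⟨l, j⟩
  · subst hq; simp; lia
  · simp [oneUser, Pi.single_eq_of_ne hq]

theorem tsum_ite_add_oneUser (x : State N) (l : Fin L) (j : Fin (N l)) (f : State N → ℝ≥0∞) :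
    ∑' y, (if x + oneUser l j = y + oneUser l j then f y else 0) = f x := by
  rw [tsum_eq_single x fun y hy => if_neg fun h => hy (add_right_cancel h).symm, if_pos rfl]

/-- The Poisson recursion at one coordinate, the others being unchanged. It turns a flow
proportional to the occupancy of stage `j` into a constant multiple of the weight of the state with
one user fewer. -/
theorem poissonState_add_oneUser (hw : ∀ l j, 0 ≤ offeredLoad (lam0 l) (D l) j) (z : State N)
    (l : Fin L) (j : Fin (N l)) (c : ℝ) :
    poissonState lam0 D (z + oneUser l j) * ENNReal.ofReal (((z + oneUser l j) ⟨l, j⟩ : ℕ) * c) =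
      poissonState lam0 D z * ENNReal.ofReal (offeredLoad (lam0 l) (D l) j * c) := by
  have hrest : ∏ q ∈ Finset.univ.erase ⟨l, j⟩,
      poissonMeasure (offeredLoad (lam0 q.1) (D q.1) q.2).toNNReal {(z + oneUser l j) q} =
      ∏ q ∈ Finset.univ.erase ⟨l, j⟩,
        poissonMeasure (offeredLoad (lam0 q.1) (D q.1) q.2).toNNReal {z q} :=
    Finset.prod_congr rfl fun q hq => by
      simp [oneUser, Pi.single_eq_of_ne (Finset.ne_of_mem_erase hq)]
  rw [poissonState_apply, poissonState_apply,
    ← Finset.mul_prod_erase _ _ (Finset.mem_univ (⟨l, j⟩ : Σ l, Fin (N l))), hrest,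
    ← Finset.mul_prod_erase _ _ (Finset.mem_univ (⟨l, j⟩ : Σ l, Fin (N l)))]
  have hs := poissonMeasure_singleton_succ (offeredLoad (lam0 l) (D l) j).toNNReal (z ⟨l, j⟩)
  rw [Real.coe_toNNReal _ (hw l j)] at hs
  simp only [Pi.add_apply, oneUser_apply_self]
  push_cast
  rw [ENNReal.ofReal_mul (by positivity), ENNReal.ofReal_mul (hw l j), ← mul_assoc, mul_right_comm _ _
    (ENNReal.ofReal (_ + 1)), hs]
  ring

/-- Total rate of the arrivals. -/
noncomputable def arrivalRate (N : Fin L → ℕ) (lam0 : Fin L → ℝ) : ℝ≥0∞ :=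
  ∑ l, ∑ j : Fin (N l), if j.val = 0 then ENNReal.ofReal (lam0 l) else 0

theorem arrivalRate_ne_top : arrivalRate N lam0 ≠ ∞ :=
  ENNReal.sum_ne_top.2 fun l _ => ENNReal.sum_ne_top.2 fun j _ => by split_ifs <;> simp

theorem sum_ite_val_eq_succ {n : ℕ} (j : Fin n) (c : ℝ≥0∞) (hc : ¬ j.val + 1 < n → c = 0) :
    ∑ k : Fin n, (if k.val = j.val + 1 then c else 0) = c := by
  by_cases h : j.val + 1 < n
  · rw [Finset.sum_eq_single ⟨j.val + 1, h⟩ (fun k _ hk => if_neg fun h' => hk (Fin.ext h'))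
      (by simp), if_pos rfl]
  · rw [hc h]; simp

theorem ite_val_eq_zero_add_sum {n : ℕ} (k : Fin n) (c : ℝ≥0∞) :
    (if k.val = 0 then c else 0) + ∑ j : Fin n, (if k.val = j.val + 1 then c else 0) = c := by
  by_cases h : k.val = 0
  · simp [h]
  · rw [if_neg h, zero_add, Finset.sum_eq_single ⟨k.val - 1, by lia⟩]
    · exact if_pos (by simp only; lia)
    · exact fun j _ hj => if_neg fun h' => hj (Fin.ext (by simp only; lia))
    · simp

/-- The target state is written without subtraction and may fail to exist when stage `j` is empty;
`hc` makes both sides vanish in that case. -/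
theorem tsum_ite_and_oneUser (p : Prop) [Decidable p] (x : State N) (l : Fin L)
    (j k : Fin (N l)) {c : ℝ≥0∞} (hc : x ⟨l, j⟩ = 0 → c = 0) :
    ∑' y, (if p ∧ y + oneUser l j = x + oneUser l k then c else 0) = if p then c else 0 := by
  by_cases hp : p
  · simp only [hp, true_and, if_true]
    by_cases hx : x ⟨l, j⟩ = 0
    · simp [hc hx]
    · obtain ⟨z, rfl⟩ := exists_eq_add_oneUser hx
      rw [add_right_comm]
      simp_rw [eq_comm (b := _ + oneUser l k + oneUser l j)]
      exact tsum_ite_add_oneUser (z + oneUser l k) l j fun _ => c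
  · simp [hp]

theorem tsum_ite_oneUser_eq (x : State N) (l : Fin L)
    (j : Fin (N l)) {c : ℝ≥0∞} (hc : x ⟨l, j⟩ = 0 → c = 0) :
    ∑' y, (if y + oneUser l j = x then c else 0) = c := by
  by_cases hx : x ⟨l, j⟩ = 0
  · simp [hc hx]
  · obtain ⟨z, rfl⟩ := exists_eq_add_oneUser hx
    simp_rw [eq_comm (b := z + oneUser l j)]
    exact tsum_ite_add_oneUser z l j fun _ => c

theorem transitionRate_arrival_ne_zero (hlam0 : ∀ l, 0 < lam0 l) (x : State N) (l : Fin L)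
    (h : 0 < N l) : transitionRate lam0 D x (x + oneUser l ⟨0, h⟩) ≠ 0 := fun h0 => by
  simp only [transitionRate, add_eq_zero, Finset.sum_eq_zero_iff] at h0
  have := h0.1.1 l (Finset.mem_univ _) ⟨0, h⟩ (Finset.mem_univ _)
  simp at this
  exact absurd this (hlam0 l).not_ge

variable [∀ l, IsProbabilityMeasure (D l)]

theorem tsum_transitionRate (hduration : ∀ l, ∀ᵐ s ∂(D l), 0 < s.1)
    (hdwell : ∀ l, ∀ᵐ s ∂(D l), ∀ j, 0 ≤ s.2 j)
    (hreach : ∀ l j, 0 < (D l).real {s | Reaches s j})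
    (hmean : ∀ l j, 0 < meanHoldingTime (D l) j) (x : State N) :
    ∑' y, transitionRate lam0 D x y =
      arrivalRate N lam0 + ∑ l, ∑ j : Fin (N l), ENNReal.ofReal (x ⟨l, j⟩ * serviceRate (D l) j) := by
  have h1 : ∀ l (j : Fin (N l)), ∑' y, (if j.val = 0 ∧ y = x + oneUser l j then
      ENNReal.ofReal (lam0 l) else 0) = if j.val = 0 then ENNReal.ofReal (lam0 l) else 0 := by
    intro l j
    by_cases h : j.val = 0 <;> simp [h]
  have hz : ∀ l (j : Fin (N l)) (p : ℝ), x ⟨l, j⟩ = 0 →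
      ENNReal.ofReal (x ⟨l, j⟩ * serviceRate (D l) j * p) = 0 := fun l j p h => by simp [h]
  simp only [transitionRate, ENNReal.tsum_add, Summable.tsum_finsetSum fun _ _ => ENNReal.summable]
  simp_rw [h1, tsum_ite_and_oneUser _ x _ _ _ (hz _ _ _), tsum_ite_oneUser_eq x _ _ (hz _ _ _)]
  rw [add_assoc, arrivalRate, ← Finset.sum_add_distrib]
  congr 1
  refine Finset.sum_congr rfl fun l _ => ?_
  rw [← Finset.sum_add_distrib]
  refine Finset.sum_congr rfl fun j _ => ?_
  have hb : 0 ≤ (x ⟨l, j⟩ : ℝ) * serviceRate (D l) j :=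
    mul_nonneg (Nat.cast_nonneg _) (serviceRate_pos (hmean l j)).le
  rw [sum_ite_val_eq_succ _ _ fun h => by rw [advanceProb_eq_zero h]; simp,
    ← ENNReal.ofReal_add (mul_nonneg hb (advanceProb_nonneg j)) (mul_nonneg hb (exitProb_nonneg j)),
    ← mul_add, advanceProb_add_exitProb (hduration l) (hdwell l) (hreach l j), mul_one]

/-- Balance holds piecewise: inflow into `x` by an arrival or a move into stage `k` equals the
outflow from stage `k`, and inflow by exits equals the outflow by arrivals, since the ending
probabilities of a route sum to `1`. -/
theorem tsum_poissonState_mul_transitionRate (hlam0 : ∀ l, 0 < lam0 l)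
    (hduration : ∀ l, ∀ᵐ s ∂(D l), 0 < s.1)
    (hdwell : ∀ l, ∀ᵐ s ∂(D l), ∀ j, 0 ≤ s.2 j)
    (hreach : ∀ l j, 0 < (D l).real {s | Reaches s j})
    (hmean : ∀ l j, 0 < meanHoldingTime (D l) j)
    (hw : ∀ l j, 0 ≤ offeredLoad (lam0 l) (D l) j) (x : State N) :
    ∑' y, poissonState lam0 D y * transitionRate lam0 D y x =
      poissonState lam0 D x * (arrivalRate N lam0 +
        ∑ l, ∑ j : Fin (N l), ENNReal.ofReal (x ⟨l, j⟩ * serviceRate (D l) j)) := by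
  have hwb := fun l j => offeredLoad_mul_serviceRate (hduration l) (hdwell l) (lam0 l) (hmean l j)
  have hb := fun l j => serviceRate_pos (hmean l j)
  have h1 : ∀ l (j : Fin (N l)), ∑' y, (if j.val = 0 ∧ x = y + oneUser l j then
      poissonState lam0 D y * ENNReal.ofReal (lam0 l) else 0) =
      if j.val = 0 then poissonState lam0 D x * ENNReal.ofReal (x ⟨l, j⟩ * serviceRate (D l) j)
        else 0 := by
    intro l j
    by_cases h : j.val = 0
    · simp only [h, true_and, if_true]
      by_cases hx : x ⟨l, j⟩ = 0
      · simp only [hx, Nat.cast_zero, zero_mul, ENNReal.ofReal_zero, mul_zero]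
        refine ENNReal.tsum_eq_zero.2 fun y => if_neg fun hxy => ?_
        simp [hxy] at hx
      · obtain ⟨z, rfl⟩ := exists_eq_add_oneUser hx
        rw [tsum_ite_add_oneUser z l j fun y => poissonState lam0 D y * ENNReal.ofReal (lam0 l),
          poissonState_add_oneUser hw z l j _, hwb, h,
          reachProb_zero (hduration l) j.pos, mul_one]
    · simp [h]
  have h2 : ∀ l (j k : Fin (N l)), ∑' y, (if k.val = j.val + 1 ∧
      x + oneUser l j = y + oneUser l k then poissonState lam0 D y *
        ENNReal.ofReal (y ⟨l, j⟩ * serviceRate (D l) j * advanceProb (D l) j) else 0) =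
      if k.val = j.val + 1 then
        poissonState lam0 D x * ENNReal.ofReal (x ⟨l, k⟩ * serviceRate (D l) k) else 0 := by
    intro l j k
    by_cases h : k.val = j.val + 1
    · have hkj : k ≠ j := fun h' => by rw [h'] at h; lia
      simp only [h, true_and, if_true]
      by_cases hx : x ⟨l, k⟩ = 0
      · simp only [hx, Nat.cast_zero, zero_mul, ENNReal.ofReal_zero, mul_zero]
        refine ENNReal.tsum_eq_zero.2 fun y => if_neg fun hxy => ?_
        have := congrFun hxy ⟨l, k⟩
        simp [hx, oneUser_apply_of_ne l hkj] at this
      -- The only predecessor is `z + oneUser l j`. Its weight and that of `z + oneUser l k` are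
      -- both compared with the weight of `z`.
      · obtain ⟨z, rfl⟩ := exists_eq_add_oneUser hx
        rw [add_right_comm, tsum_ite_add_oneUser (z + oneUser l j) l k fun y =>
          poissonState lam0 D y *
            ENNReal.ofReal (y ⟨l, j⟩ * serviceRate (D l) j * advanceProb (D l) j), mul_assoc,
          poissonState_add_oneUser hw z l j _,
          poissonState_add_oneUser hw z l k _, hwb, ← mul_assoc, hwb, mul_assoc,
          reachProb_mul_advanceProb (hduration l) (hdwell l) (hreach l j), h]
    · simp [h]
  have h3 : ∀ l (j : Fin (N l)), ∑' y, (if x + oneUser l j = y then poissonState lam0 D y *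
        ENNReal.ofReal (y ⟨l, j⟩ * serviceRate (D l) j * exitProb (D l) j) else 0) =
      poissonState lam0 D x * ENNReal.ofReal (lam0 l * endProb (D l) j) := by
    intro l j
    simp_rw [eq_comm (a := x + oneUser l j)]
    rw [tsum_ite_eq, mul_assoc,
      poissonState_add_oneUser hw x l j _, ← mul_assoc,
      hwb, mul_assoc, reachProb_mul_exitProb (hduration l) (hdwell l) (hreach l j)]
  have h4 : ∀ l, ∑ j : Fin (N l), ENNReal.ofReal (lam0 l * endProb (D l) j) =
      ∑ j : Fin (N l), if j.val = 0 then ENNReal.ofReal (lam0 l) else 0 := by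
    intro l
    -- A route without stages contributes empty sums on both sides.
    rcases Nat.eq_zero_or_pos (N l) with h | h
    · have : IsEmpty (Fin (N l)) := by rw [h]; infer_instance
      simp
    · rw [← ENNReal.ofReal_sum_of_nonneg fun j _ => mul_nonneg (hlam0 l).le (endProb_nonneg j),
        ← Finset.mul_sum, sum_endProb (hduration l) (hdwell l) h, mul_one,
        Finset.sum_eq_single ⟨0, h⟩ (fun j _ hj => if_neg fun h' => hj (Fin.ext h')) (by simp),
        if_pos rfl]
  simp only [transitionRate, mul_add, Finset.mul_sum, mul_ite, mul_zero, ENNReal.tsum_add,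
    Summable.tsum_finsetSum fun _ _ => ENNReal.summable, h1, h2, h3]
  rw [add_comm, arrivalRate, Finset.mul_sum]
  congr 1
  · exact Finset.sum_congr rfl fun l _ => by rw [← Finset.mul_sum, h4]
  · rw [← Finset.sum_add_distrib]
    refine Finset.sum_congr rfl fun l _ => ?_
    rw [Finset.sum_comm (s := Finset.univ (α := Fin (N l))), ← Finset.sum_add_distrib]
    exact Finset.sum_congr rfl fun k _ => ite_val_eq_zero_add_sum k _

theorem tsum_poissonState_mul_rate_ne_top (hduration : ∀ l, ∀ᵐ s ∂(D l), 0 < s.1)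
    (hdwell : ∀ l, ∀ᵐ s ∂(D l), ∀ j, 0 ≤ s.2 j)
    (hreach : ∀ l j, 0 < (D l).real {s | Reaches s j})
    (hmean : ∀ l j, 0 < meanHoldingTime (D l) j)
    (hw : ∀ l j, 0 ≤ offeredLoad (lam0 l) (D l) j) :
    ∑' x, poissonState lam0 D x * ∑' y, transitionRate lam0 D x y ≠ ∞ := by
  simp_rw [tsum_transitionRate hduration hdwell hreach hmean, mul_add, ENNReal.tsum_add,
    Finset.mul_sum, Summable.tsum_finsetSum fun _ _ => ENNReal.summable]
  rw [ENNReal.tsum_mul_right, (poissonState lam0 D).tsum_coe, one_mul]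
  refine ENNReal.add_ne_top.2 ⟨arrivalRate_ne_top, ENNReal.sum_ne_top.2 fun l _ =>
    ENNReal.sum_ne_top.2 fun j _ => ?_⟩
  -- Only states with a user in stage `j` contribute; removing that user reduces the sum to the
  -- throughput times the total mass.
  rw [← (add_left_injective (oneUser l j : State N)).tsum_eq]
  · simp_rw [poissonState_add_oneUser hw _ l j _]
    rw [ENNReal.tsum_mul_right, (poissonState lam0 D).tsum_coe, one_mul]
    exact ENNReal.ofReal_ne_top
  · intro x hx
    have : x ⟨l, j⟩ ≠ 0 := fun h => hx (by simp [h])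
    obtain ⟨z, rfl⟩ := exists_eq_add_oneUser this
    exact ⟨z, rfl⟩

theorem transitionRate_move_ne_zero (hduration : ∀ l, ∀ᵐ s ∂(D l), 0 < s.1)
    (hdwell : ∀ l, ∀ᵐ s ∂(D l), ∀ j, 0 ≤ s.2 j)
    (hreach : ∀ l j, 0 < (D l).real {s | Reaches s j})
    (hmean : ∀ l j, 0 < meanHoldingTime (D l) j) (z : State N) (l : Fin L) {j k : Fin (N l)}
    (h : k.val = j.val + 1) :
    transitionRate lam0 D (z + oneUser l j) (z + oneUser l k) ≠ 0 := fun h0 => by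
  simp only [transitionRate, add_eq_zero, Finset.sum_eq_zero_iff] at h0
  have h1 := h0.1.2 l (Finset.mem_univ _) j (Finset.mem_univ _) k (Finset.mem_univ _)
  rw [if_pos ⟨h, add_right_comm _ _ _⟩, ENNReal.ofReal_eq_zero] at h1
  have hadv : 0 < advanceProb (D l) j := by
    have h2 := reachProb_mul_advanceProb (hduration l) (hdwell l) (hreach l j)
    have h3 := hreach l k
    rw [← reachProb_val, h, ← h2] at h3
    exact pos_of_mul_pos_right h3 (by rw [reachProb_val]; exact (hreach l j).le)
  refine absurd h1 (not_le.2 (mul_pos (mul_pos (Nat.cast_pos.2 ?_) (serviceRate_pos (hmean l j)))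
    hadv))
  simp

/-- Only from the last stage is an exit certain to have positive rate: the ending probability of an
earlier stage may be zero. -/
theorem transitionRate_exit_ne_zero (hduration : ∀ l, ∀ᵐ s ∂(D l), 0 < s.1)
    (hdwell : ∀ l, ∀ᵐ s ∂(D l), ∀ j, 0 ≤ s.2 j)
    (hreach : ∀ l j, 0 < (D l).real {s | Reaches s j})
    (hmean : ∀ l j, 0 < meanHoldingTime (D l) j) (z : State N) (l : Fin L) {j : Fin (N l)}
    (h : ¬ j.val + 1 < N l) : transitionRate lam0 D (z + oneUser l j) z ≠ 0 := fun h0 => by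
  simp only [transitionRate, add_eq_zero, Finset.sum_eq_zero_iff] at h0
  have h1 := h0.2 l (Finset.mem_univ _) j (Finset.mem_univ _)
  have h2 := advanceProb_add_exitProb (hduration l) (hdwell l) (hreach l j)
  rw [advanceProb_eq_zero h, zero_add] at h2
  rw [if_pos rfl, ENNReal.ofReal_eq_zero, h2, mul_one] at h1
  refine absurd h1 (not_le.2 (mul_pos (Nat.cast_pos.2 ?_) (serviceRate_pos (hmean l j))))
  simp

/-- Every state of the memoryless network can be reached from every other state. -/
theorem transitionRate_irreducible (hlam0 : ∀ l, 0 < lam0 l)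
    (hduration : ∀ l, ∀ᵐ s ∂(D l), 0 < s.1)
    (hdwell : ∀ l, ∀ᵐ s ∂(D l), ∀ j, 0 ≤ s.2 j)
    (hreach : ∀ l j, 0 < (D l).real {s | Reaches s j})
    (hmean : ∀ l j, 0 < meanHoldingTime (D l) j) (x y : State N) :
    Relation.ReflTransGen (fun a b => transitionRate lam0 D a b ≠ 0) x y := by
  set R : State N → State N → Prop := fun a b => transitionRate lam0 D a b ≠ 0
  have hup : ∀ (l : Fin L) (i : ℕ) (hi : i < N l) (z : State N),
      Relation.ReflTransGen R z (z + oneUser l ⟨i, hi⟩) := by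
    intro l i
    induction i with
    | zero => exact fun hi z => .single (transitionRate_arrival_ne_zero hlam0 z l hi)
    | succ i ih =>
      exact fun hi z => (ih (by lia) z).tail
        (transitionRate_move_ne_zero hduration hdwell hreach hmean z l rfl)
  -- A user is removed by moving it through the remaining stages and out at the end; `m` is the
  -- number of stages after `i`.
  have hdown : ∀ (l : Fin L) (m i : ℕ) (hi : i < N l) (_ : N l = i + m + 1) (z : State N),
      Relation.ReflTransGen R (z + oneUser l ⟨i, hi⟩) z := by
    intro l m
    induction m with
    | zero =>
      exact fun i hi hm z => .single
        (transitionRate_exit_ne_zero hduration hdwell hreach hmean z l (by simp only; lia))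
    | succ m ih =>
      exact fun i hi hm z => .head (transitionRate_move_ne_zero hduration hdwell hreach hmean z l
        (k := ⟨i + 1, by lia⟩) rfl) (ih (i + 1) (by lia) (by lia) z)
  -- All states communicate through the empty one, by induction on the number of users.
  have hzero : ∀ (m : ℕ) (x : State N), ∑ q, x q = m →
      Relation.ReflTransGen R 0 x ∧ Relation.ReflTransGen R x 0 := by
    intro m
    induction m with
    | zero =>
      intro x hx
      have : x = 0 := funext fun q => Finset.sum_eq_zero_iff.1 hx q (Finset.mem_univ _)
      rw [this]
      exact ⟨.refl, .refl⟩
    | succ m ih =>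
      intro x hx
      obtain ⟨⟨l, j⟩, -, hq⟩ := Finset.exists_ne_zero_of_sum_ne_zero (hx.trans_ne m.succ_ne_zero)
      obtain ⟨z, rfl⟩ := exists_eq_add_oneUser hq
      have hz : ∑ q, z q = m := by
        simp only [Pi.add_apply, Finset.sum_add_distrib, oneUser, Finset.sum_pi_single',
          Finset.mem_univ, if_true] at hx
        simpa using hx
      exact ⟨(ih z hz).1.trans (hup l j j.2 z),
        (hdown l (N l - 1 - j) j j.2 (by have := j.2; lia) z).trans (ih z hz).2⟩
  exact (hzero _ x rfl).2.trans (hzero _ y rfl).1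

end Memoryless

end MobileNetwork

/-! ### The common stationary distribution of the two networks. -/

theorem mainTheorem2 {L : ℕ} {N : Fin L → ℕ} {Ω : Type*} [MeasurableSpace Ω]
    (μ : Measure Ω) [IsProbabilityMeasure μ]
    (lam0 : Fin L → ℝ) (D : ∀ l : Fin L, Measure (MobileNetwork.Session (N l)))
    [∀ l, IsProbabilityMeasure (D l)]
    (A : Fin L → ℕ → Ω → ℝ) (S : ∀ l : Fin L, ℕ → Ω → MobileNetwork.Session (N l))
    (hlam0 : ∀ l, 0 < lam0 l)
    (hduration : ∀ l, ∀ᵐ s ∂(D l), 0 < s.1)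
    (hdwell : ∀ l, ∀ᵐ s ∂(D l), ∀ j, 0 ≤ s.2 j)
    (hreach : ∀ l j, 0 < (D l).real {s | MobileNetwork.Reaches s j})
    (hint : ∀ l j, Integrable (fun s => MobileNetwork.holdingTime s j)
      (cond (D l) {s | MobileNetwork.Reaches s j}))
    (hmean : ∀ l j, 0 < MobileNetwork.meanHoldingTime (D l) j)
    (hnet : MobileNetwork.IsNetwork μ lam0 D A S) :
    ∃ π : PMF (MobileNetwork.State N),
      -- `π` is the product of the Poisson laws with means `w l j`
      (∀ x, π x = ENNReal.ofReal (∏ l, ∏ j : Fin (N l),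
        Real.exp (-MobileNetwork.offeredLoad (lam0 l) (D l) j) *
          MobileNetwork.offeredLoad (lam0 l) (D l) j ^ x ⟨l, j⟩ / (x ⟨l, j⟩)!)) ∧
      -- the network that has been running forever has law `π` at each time
      (∀ (t : ℝ) (x : MobileNetwork.State N),
        μ {ω | ∀ q, MobileNetwork.occupancy A S Set.univ t q ω = x q} = π x) ∧
      -- the network that starts empty at time `0` converges in law to `π`
      (∀ x : MobileNetwork.State N, Tendsto
        (fun t : ℝ => μ {ω | ∀ q, MobileNetwork.occupancy A S (Set.Ici 0) t q ω = x q})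
        atTop (𝓝 (π x))) ∧
      -- `π` is the unique stationary distribution of the memoryless network
      (∀ ν : PMF (MobileNetwork.State N),
        MobileNetwork.IsMemorylessStationary lam0 D ν ↔ ν = π) := by
  have hload := fun l j => MobileNetwork.offeredLoad_eq (hduration l) (hdwell l) (lam0 l) j
  have hwpos : ∀ l j, 0 < MobileNetwork.offeredLoad (lam0 l) (D l) j := fun l j => by
    rw [hload]
    exact mul_pos (hlam0 l) (mul_pos (hreach l j) (hmean l j))
  have hw := fun l j => (hwpos l j).le
  have hnn : ∀ l j, 0 ≤ (D l).real {s | MobileNetwork.Reaches s j} *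
      MobileNetwork.meanHoldingTime (D l) j := fun l j =>
    (mul_pos (hreach l j) (hmean l j)).le
  have hbal : MobileNetwork.IsMemorylessStationary lam0 D
      (MobileNetwork.poissonState lam0 D) := fun x => by
    rw [MobileNetwork.tsum_transitionRate hduration hdwell hreach hmean,
      MobileNetwork.tsum_poissonState_mul_transitionRate hlam0 hduration hdwell hreach hmean hw]
  refine ⟨MobileNetwork.poissonState lam0 D, MobileNetwork.poissonState_apply_eq_ofReal hw,
    fun t x => ?_, fun x => ?_, fun ν => ⟨fun hν => ?_, fun hν => hν ▸ hbal⟩⟩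
  · rw [hnet.measure_occupancy_eq hlam0 hdwell hreach hint MeasurableSet.univ,
      MobileNetwork.poissonState_apply]
    refine Finset.prod_congr rfl fun q _ => ?_
    rw [MobileNetwork.markedMass_presentSet_univ (hdwell q.1) t q.2 (hreach _ _) (hint _ _),
      ENNReal.toReal_ofReal (hnn _ _), hload]
  · simp_rw [fun t => hnet.measure_occupancy_eq hlam0 hdwell hreach hint
      (measurableSet_Ici (a := (0 : ℝ))) t x]
    rw [MobileNetwork.poissonState_apply]
    -- The law at each time is a product of Poisson laws, so convergence of the means and continuity
    -- of Poisson weights in the mean suffice.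
    refine ENNReal.tendsto_finsetProd_of_ne_top _ (fun q _ => ?_) fun q _ => measure_ne_top _ _
    refine ((MobileNetwork.continuous_poissonMeasure_singleton (x q)).tendsto _).comp ?_
    rw [hload]
    have h := (ENNReal.tendsto_toReal ENNReal.ofReal_ne_top).comp
      (MobileNetwork.tendsto_markedMass_presentSet_Ici (hdwell q.1) q.2 (hreach _ _) (hint _ _))
    rw [ENNReal.toReal_ofReal (hnn _ _)] at h
    exact h.const_mul (lam0 q.1)
  -- The remaining goal is that every state has positive weight, which needs strictly positive
  -- offered loads.
  · refine PMF.eq_of_balance (fun x => ?_)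
      (MobileNetwork.tsum_poissonState_mul_rate_ne_top hduration hdwell hreach hmean hw)
      (MobileNetwork.transitionRate_irreducible hlam0 hduration hdwell hreach hmean) hbal hν
    rw [MobileNetwork.poissonState_apply_eq_ofReal hw]
    refine (ENNReal.ofReal_pos.2 (Finset.prod_pos fun l _ => Finset.prod_pos fun j _ => ?_)).ne'
    have := hwpos l j
    positivity
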